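/- **Setting.** Players $1,\dots,m$ communicate over an undirected connected graph $\mathcal G$ with vertex set $\{1,\dots,m\}$ and edge set $\mathcal E$; $\mathcal N_i$ is the set of neighbours of $i$. Player $i$ has a nonempty compact convex set $\Omega_i\subset\mathbb R^{n_i}$, a linear map $A_i:\mathbb R^{n_i}\to\mathbb R^q$, a vector $b_i\in\mathbb R^q$ and a cost $f_i:\mathbb R^n\to\mathbb R$, $n=\sum_i n_i$, with $f_i(\cdot,x_{-i})$ convex and continuously differentiable for every $x_{-i}$; the set $\mathcal X=\prod_i\Omega_i\cap\{x:\sum_iA_ix_i\le\sum_ib_i\}$ is nonempty (so every $\mathcal X_i(x_{-i})=\{y\in\Omega_i:(y,x_{-i})\in\mathcal X\}$ with $x\in\mathcal X$ is nonempty, compact and convex). The pseudogradient $F(x)=(\nabla_{x_i}f_i(x))_{i}$ is $L_F$-Lipschitz and $\mu$-strongly monotone on $\mathbb R^n$, $\mu>0$. Put $E_{ij}=I_q$ if $i<j$ and $E_{ij}=-I_q$ if $i>j$. The variables are $U=(x,u,w)$ with $x=(x_i)$, $u=(u_i)$, $u_i\in\mathbb R^q$, and two vectors $w_{(i,j),i},w_{(i,j),j}\in\mathbb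 R^q$ for every undirected edge $(i,j)$. Let $0<\alpha_i<1$, and let $\kappa_{(i,j)}=\kappa_{(j,i)}>0$, $\sigma_i>0$, $\tau_i>0$ satisfy, with $k_i=\sum_{j\in\mathcal N_i}\kappa_{(i,j)}$, $$\sigma_i<\frac{9(1-\alpha_i)^2}{16k_i},\qquad \tau_i<\frac{2\mu(1-\alpha_i)^2}{(1-\alpha_i)L_F^2+8\mu\sigma_i(1+\sigma_ik_i)\lambda_{\max}(A_i^{\rm T}A_i)}$$ (a bound with zero denominator is no restriction). Let $T_S$ be the block diagonal matrix with blocks $\tau_i^{-1}I_{n_i}$ (for $x_i$), $\sigma_i^{-1}I_q$ (for $u_i$) and $\kappa_{(i,j)}^{-1}I_{2q}$ (for $w_{(i,j)}$), $\|U\|_{T_S}^2=\langle U,T_SU\rangle$ and $\kappa(T_S)=\lambda_{\max}(T_S)/\lambda_{\min}(T_S)$. **Operators.** $T(x,u,w)=(x^+,u^+,w^+)$ is given by $$\bar w_{(i,j),i}=\tfrac12\big(w_{(i,j),i}+w_{(i,j),j}\big)+\tfrac{\kappa_{(i,j)}}2\big(E_{ij}u_i+E_{ji}u_j\big),\qquad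 \bar u_i=\mathcal P_{\mathbb R^q_+}\Big(u_i+\sigma_i\big(A_ix_i-b_i-\sum_{j\in\mathcal N_i}E_{ij}\bar w_{(i,j),i}\big)\Big),$$ $$x_i^+=\bar x_i=\mathcal P_{\Omega_i}\big(x_i-\tau_i(\nabla_{x_i}f_i(x)+A_i^{\rm T}\bar u_i)\big),\quad u_i^+=\bar u_i+\sigma_iA_i(\bar x_i-x_i),\quad w_{(i,j),i}^+=\bar w_{(i,j),i}+\kappa_{(i,j)}E_{ij}(\bar u_i-u_i),$$ where $\mathcal P$ denotes Euclidean projection. Put $R=\mathrm{Id}-T$, and let $R_iU$ be obtained from $RU$ by replacing all components by $0$ except those of player $i$ (those of $x_i$, $u_i$ and $w_{(i,j),i}$, $j\in\mathcal N_i$). Let $U^*=(x^*,u^*,w^*)$ be any zero of $T_A+T_M+T_C$, where $T_AU=(\partial\delta_{\prod\Omega_i}(x),\partial\delta_{\mathbb R_+^{mq}}(u),\partial\delta_{\mathcal C}^\star(w))$, $T_MU=(A^{\rm T}u,-Ax+\Pi^{\rm T}w,-\Pi u)$, $T_CU=(F(x),b,0)$, $A=\mathrm{blkdiag}(A_i)$,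 $b=(b_i)$, $(\Pi u)_{(i,j),i}=E_{ij}u_i$, $\mathcal C=\{z: z_{(i,j),i}+z_{(i,j),j}=0\ \forall (i,j)\in\mathcal E\}$, $\delta$ denotes an indicator function and $\delta^\star$ its conjugate. **Asynchronous iteration.** At iteration $k=0,1,2,\dots$ a random player $i_k$ is active, with $\mathrm{Prob}(i_k=i)=p_i>0$; put $p_{\min}=\min_ip_i$. The delays $\phi_i^k$ (players) and $\varphi_{(i,j)}^k$ (edges) are integers in $[0,\varepsilon]$, $\varepsilon\ge1$ an integer. They may be random, and $i_k$ is independent of $i_0,\dots,i_{k-1}$ together with the delays of the iterations $0,\dots,k$ (for deterministic delays: independent of $i_0,\dots,i_{k-1}$). Let $U_0$ be deterministic, $U_l=U_0$ for $l<0$; let $\hat U_k$ have the components $x_i,u_i$ of $U_{k-\phi_i^k}$ and $w_{(i,j)}$ of $U_{k-\varphi^k_{(i,j)}}$; and let $$U_{k+1}=U_k-\frac{\eta}{mp_{i_k}}R_{i_k}\hat U_k,\qquad \tilde U_{k+1}=U_k-\eta R\hat U_k .$$ Let $\mathcal Z_k=\sigma(U_0,U_1,\hat U_1,\dots,U_k,\hat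 U_k)$, $\mathbf U_k=(U_k,U_{k-1},\dots,U_{k-\varepsilon})$, $\mathbf U^*=(U^*,\dots,U^*)$ and $\|\mathbf Z\|_\Phi^2=\langle\mathbf Z,\Phi\mathbf Z\rangle$, where, with $c=\sqrt{p_{\min}/\kappa(T_S)}$, $\Phi(Z_0,\dots,Z_\varepsilon)=(\tilde Z_0,\dots,\tilde Z_\varepsilon)$ is given by $\tilde Z_0=T_SZ_0+\varepsilon c\,T_S(Z_0-Z_1)$, $\tilde Z_l=c\,T_S\big((l-\varepsilon-1)Z_{l-1}+(2\varepsilon-2l+1)Z_l+(l-\varepsilon)Z_{l+1}\big)$ for $1\le l\le\varepsilon-1$, and $\tilde Z_\varepsilon=c\,T_S(Z_\varepsilon-Z_{\varepsilon-1})$. **Theorem.** Suppose that $$\beta=\frac1\eta-\frac{2\varepsilon}{m}\sqrt{\frac{\kappa(T_S)}{p_{\min}}}-\frac{\kappa(T_S)}{m\,p_{\min}}>0 .$$ Then, for every $k\ge0$, $\|\mathbf U_k-\mathbf U^*\|_\Phi^2$ is integrable and, almost surely, $$\mathbb E\big(\|\mathbf U_{k+1}-\mathbf U^*\|_\Phi^2\,\big|\,\mathcal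 Z_k\big)\le\|\mathbf U_k-\mathbf U^*\|_\Phi^2-\frac\beta m\,\|\tilde U_{k+1}-U_k\|_{T_S}^2 .$$ Furthermore, there is an event $\tilde\Omega$ of probability $1$ such that for every $\xi\in\tilde\Omega$ the sequence $\big(\|\mathbf U_k(\xi)-\mathbf U^*\|_\Phi^2\big)_{k\in\mathbb N}$ converges in $\mathbb R$. -/

import Mathlib

open MeasureTheory ProbabilityTheory Filter Topology

noncomputable section

namespace GNE

/-! ### Convex analysis and eigenvalues -/

section General

variable {E : Type*} [NormedAddCommGroup E] [InnerProductSpace ℝ E]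

/-- The indicator function of a set: `0` on the set and `+∞` outside. -/
def indicatorFun (C : Set E) (x : E) : EReal :=
  open Classical in if x ∈ C then 0 else ⊤

/-- The convex conjugate `f⋆ v = sup_x (⟨v, x⟩ - f x)`. -/
def conjugate (f : E → EReal) (v : E) : EReal :=
  ⨆ x : E, ((inner ℝ v x : ℝ) : EReal) - f x

/-- The subdifferential `∂f x = {v | f x + ⟨v, y - x⟩ ≤ f y for all y}`. -/
def subdiff (f : E → EReal) (x : E) : Set E :=
  {v | ∀ y : E, f x + ((inner ℝ v (y - x) : ℝ) : EReal) ≤ f y}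

/-- The projection onto `C`, i.e. the minimiser over `y ∈ C` of `‖y - x‖`
(unique when `C` is nonempty, closed and convex and `E` is complete). -/
def proj (C : Set E) (x : E) : E :=
  Classical.epsilon fun y => y ∈ C ∧ ∀ z ∈ C, ‖y - x‖ ≤ ‖z - x‖

/-- The largest eigenvalue of a symmetric operator. -/
def eigMax (L : E →ₗ[ℝ] E) : ℝ := sSup {r : ℝ | Module.End.HasEigenvalue L r}

/-- The smallest eigenvalue of a symmetric operator. -/
def eigMin (L : E →ₗ[ℝ] E) : ℝ := sInf {r : ℝ | Module.End.HasEigenvalue L r}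

/-- The condition number of a positive definite operator. -/
def condNumber (L : E →ₗ[ℝ] E) : ℝ := eigMax L / eigMin L

/-- The squared weighted norm `‖x‖²_L = ⟨x, L x⟩`. -/
def normSq (L : E →ₗ[ℝ] E) (x : E) : ℝ := inner ℝ x (L x)

end General

/-! ### The variables -/

/-- `ℝ^d` with the Euclidean norm. -/
abbrev Vec (d : ℕ) := EuclideanSpace ℝ (Fin d)

/-- Strategy profiles `x = col{x_1, …, x_m}` with `x_i ∈ ℝ^{n_i}`. -/
abbrev Profile {m : ℕ} (n : Fin m → ℕ) := PiLp 2 fun i : Fin m => Vec (n i)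

/-- Local multipliers `u = col{u_1, …, u_m}` with `u_i ∈ ℝ^q`. -/
abbrev Multiplier (m q : ℕ) := PiLp 2 fun _ : Fin m => Vec q

/-- Edge variables. An undirected edge `(i, j)` carries the two vectors `w_{(i,j),i}` and
`w_{(i,j),j}` of `ℝ^q`; the vector `w_{(i,j),i}` is the entry at the dart from `i` to `j`,
so `w_{(i,j),j}` is the entry at the reversed dart. -/
abbrev EdgeVar {m : ℕ} (q : ℕ) (G : SimpleGraph (Fin m)) := PiLp 2 fun _ : G.Dart => Vec q

/-- The stacked variables `U = col{x, u, w}`. -/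
abbrev State {m : ℕ} (q : ℕ) (n : Fin m → ℕ) (G : SimpleGraph (Fin m)) :=
  WithLp 2 (Profile n × WithLp 2 (Multiplier m q × EdgeVar q G))

section StateOps

variable {m q : ℕ} {n : Fin m → ℕ} {G : SimpleGraph (Fin m)}

/-- `col{x, u, w}`. -/
def State.mk (x : ∀ i, Vec (n i)) (u : Fin m → Vec q) (w : G.Dart → Vec q) : State q n G :=
  WithLp.toLp 2 (WithLp.toLp 2 x, WithLp.toLp 2 (WithLp.toLp 2 u, WithLp.toLp 2 w))

/-- The strategy part `x` of `U`. -/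
def State.x (U : State q n G) : Profile n := U.fst

/-- The multiplier part `u` of `U`. -/
def State.u (U : State q n G) : Multiplier m q := U.snd.fst

/-- The edge part `w` of `U`. -/
def State.w (U : State q n G) : EdgeVar q G := U.snd.snd

/-- The components `x_i`, `u_i` and `w_{(i,j),i}`, `j ∈ N_i`, of player `i`;
all other components are replaced by `0`. -/
def State.block (i : Fin m) (U : State q n G) : State q n G :=
  State.mk (fun j => if j = i then State.x U j else 0) (fun j => if j = i then State.u U j else 0)
    (fun d => if d.fst = i then State.w U d else 0)

end StateOps

/-- The undirected edge underlying a dart. -/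
def edgeOf {m : ℕ} {G : SimpleGraph (Fin m)} (d : G.Dart) : G.edgeSet := ⟨d.edge, d.edge_mem⟩

/-- The sign of `E_{ij}`, where `E_{ij} = I` if `i < j` and `E_{ij} = -I` if `i > j`. -/
def eSign {m : ℕ} (i j : Fin m) : ℝ := if i < j then 1 else -1

/-! ### The game -/

/-- The data of the game: cost functions, local sets, and coupling data. -/
structure Game (m q : ℕ) (n : Fin m → ℕ) where
  /-- the cost function `f_i` -/
  cost : Fin m → Profile n → ℝ
  /-- the local set `Ω_i` -/
  localSet : ∀ i, Set (Vec (n i))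
  /-- the matrix `A_i` -/
  A : ∀ i, Vec (n i) →L[ℝ] Vec q
  /-- the vector `b_i` -/
  b : Fin m → Vec q

namespace Game

variable {m q : ℕ} {n : Fin m → ℕ} (g : Game m q n)

/-- The profile `(y, x_{-i})`. -/
def deviate (x : Profile n) (i : Fin m) (y : Vec (n i)) : Profile n :=
  WithLp.toLp 2 (Function.update (fun j => x j) i y)

/-- The set `Ω = ∏ Ω_i`. -/
def productSet : Set (Profile n) := {x | ∀ i, x i ∈ g.localSet i}

/-- The set `𝒳 = Ω ∩ {x | ∑ A_i x_i ≤ ∑ b_i}`. -/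
def feasible : Set (Profile n) :=
  {x | x ∈ g.productSet ∧ ∀ r : Fin q, (∑ i, g.A i (x i)) r ≤ (∑ i, g.b i) r}

/-- The set `𝒳_i(x_{-i})`. -/
def feasibleAt (i : Fin m) (x : Profile n) : Set (Vec (n i)) :=
  {y | y ∈ g.localSet i ∧ deviate x i y ∈ g.feasible}

/-- The partial gradient `∇_{x_i} f_i (x_i, x_{-i})`. -/
def partialGrad (i : Fin m) (x : Profile n) : Vec (n i) :=
  gradient (fun y => g.cost i (deviate x i y)) (x i)

/-- The pseudogradient `F`. -/
def pseudoGrad (x : Profile n) : Profile n := WithLp.toLp 2 fun i => g.partialGrad i x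

/-- The standing assumptions on sets, coupling constraint and costs. -/
structure Regular : Prop where
  nonempty : ∀ i, (g.localSet i).Nonempty
  compact : ∀ i, IsCompact (g.localSet i)
  convex : ∀ i, Convex ℝ (g.localSet i)
  feasible_nonempty : g.feasible.Nonempty
  feasibleAt_good : ∀ i, ∀ x ∈ g.feasible, (g.feasibleAt i x).Nonempty ∧
    IsCompact (g.feasibleAt i x) ∧ Convex ℝ (g.feasibleAt i x)
  cost_convex : ∀ i x, ConvexOn ℝ Set.univ fun y => g.cost i (deviate x i y)
  cost_smooth : ∀ i x, ContDiff ℝ 1 fun y => g.cost i (deviate x i y)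

/-- The pseudogradient is `L`-Lipschitz continuous and `μ`-strongly monotone. -/
structure PseudoGradRegular (L μ : ℝ) : Prop where
  mu_pos : 0 < μ
  lipschitz_nonneg : 0 ≤ L
  lipschitz : ∀ x y, ‖g.pseudoGrad x - g.pseudoGrad y‖ ≤ L * ‖x - y‖
  strongMono : ∀ x y, μ * ‖x - y‖ ^ 2 ≤ inner ℝ (x - y) (g.pseudoGrad x - g.pseudoGrad y)

end Game

/-! ### Step-sizes and operators -/

/-- The step-sizes `τ_i`, `σ_i` and the edge weights `κ_{(i,j)}`. -/
structure Steps {m : ℕ} (G : SimpleGraph (Fin m)) where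
  /-- `τ_i` -/
  tau : Fin m → ℝ
  /-- `σ_i` -/
  sigma : Fin m → ℝ
  /-- `κ_{(i,j)}` -/
  kappa : G.edgeSet → ℝ

section Operators

variable {m q : ℕ} {n : Fin m → ℕ} {G : SimpleGraph (Fin m)} [DecidableRel G.Adj]

/-- `∑_{j ∈ N_i} κ_{(i,j)}`. -/
def Steps.kappaSum (s : Steps G) (i : Fin m) : ℝ :=
  ∑ d : G.Dart with d.fst = i, s.kappa (edgeOf d)

/-- The step-size conditions
`σ_i < 9 (1 - α_i)² / (16 ∑_{j ∈ N_i} κ_{(i,j)})` and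
`τ_i < 2 μ (1 - α_i)² / ((1 - α_i) L² + 8 μ σ_i (1 + σ_i ∑_{j ∈ N_i} κ_{(i,j)}) λ_max(A_iᵀ A_i))`
with positive step-sizes and `0 < α_i < 1`. They are written without division,
so that a bound with zero denominator is no restriction. -/
structure Steps.Admissible (s : Steps G) (g : Game m q n) (L μ : ℝ) (α : Fin m → ℝ) : Prop where
  alpha_pos : ∀ i, 0 < α i
  alpha_lt_one : ∀ i, α i < 1
  kappa_pos : ∀ e, 0 < s.kappa e
  sigma_pos : ∀ i, 0 < s.sigma i
  tau_pos : ∀ i, 0 < s.tau i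
  sigma_lt : ∀ i, s.sigma i * (16 * s.kappaSum i) < 9 * (1 - α i) ^ 2
  tau_lt : ∀ i, s.tau i * ((1 - α i) * L ^ 2 + 8 * μ * s.sigma i * (1 + s.sigma i * s.kappaSum i) *
    eigMax ((ContinuousLinearMap.adjoint (g.A i)).comp (g.A i)).toLinearMap) <
      2 * μ * (1 - α i) ^ 2

/-- The block diagonal operator `T_S = blkdiag{Γ⁻¹, Σ⁻¹, W⁻¹}`, where `Γ`, `Σ` and `W` are
the block diagonal matrices of the `τ_i`, the `σ_i` and the `κ_{(i,j)}`. -/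
def opTS (q : ℕ) (n : Fin m → ℕ) (s : Steps G) : State q n G →ₗ[ℝ] State q n G where
  toFun U := State.mk (fun i => (s.tau i)⁻¹ • State.x U i) (fun i => (s.sigma i)⁻¹ • State.u U i)
    (fun d => (s.kappa (edgeOf d))⁻¹ • State.w U d)
  map_add' U V := by
    simp only [State.mk, State.x, State.u, State.w, WithLp.add_fst, WithLp.add_snd,
      PiLp.add_apply, smul_add]
    rfl
  map_smul' c U := by
    simp only [State.mk, State.x, State.u, State.w, WithLp.smul_fst, WithLp.smul_snd,
      PiLp.smul_apply, smul_comm _ c, RingHom.id_apply]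
    rfl

/-- The nonnegative orthant `ℝ₊^q`. -/
def orthant (q : ℕ) : Set (Vec q) := {v | ∀ r, 0 ≤ v r}

/-- The product `(ℝ₊^q)^m`. -/
def multiplierSet (m q : ℕ) : Set (Multiplier m q) := {u | ∀ i, u i ∈ orthant q}

/-- The product over the edges of the sets `C_{(i,j)} = {(z₁, z₂) | z₁ + z₂ = 0}`. -/
def consensusSet (q : ℕ) (G : SimpleGraph (Fin m)) : Set (EdgeVar q G) :=
  {z | ∀ d : G.Dart, z d + z d.symm = 0}

/-- `T_A U = (∂δ_Ω(x), ∂δ_{ℝ₊^{mq}}(u), ∂δ⋆_C(w))`. -/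
def opTA (g : Game m q n) (U : State q n G) : Set (State q n G) :=
  {V | State.x V ∈ subdiff (indicatorFun g.productSet) (State.x U) ∧
    State.u V ∈ subdiff (indicatorFun (multiplierSet m q)) (State.u U) ∧
    State.w V ∈ subdiff (conjugate (indicatorFun (consensusSet q G))) (State.w U)}

/-- `T_M U = (Aᵀ u, -A x + Πᵀ w, -Π u)`, where `Π u` has the components
`E_{ij} u_i` and `E_{ji} u_j` on the edge `(i, j)`. -/
def opTM (g : Game m q n) (U : State q n G) : State q n G :=
  State.mk (fun i => ContinuousLinearMap.adjoint (g.A i) (State.u U i))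
    (fun i => -g.A i (State.x U i) +
      ∑ d : G.Dart with d.fst = i, eSign d.fst d.snd • State.w U d)
    (fun d => -(eSign d.fst d.snd • State.u U d.fst))

/-- `T_C U = (F x, b, 0)`. -/
def opTC (g : Game m q n) (U : State q n G) : State q n G :=
  State.mk (fun i => g.partialGrad i (State.x U)) g.b 0

/-- `zer(T_A + T_M + T_C)`. -/
def zeros (g : Game m q n) (G : SimpleGraph (Fin m)) [DecidableRel G.Adj] : Set (State q n G) :=
  {U | ∃ V ∈ opTA g U, V + opTM g U + opTC g U = 0}

/-- The prediction `w̄_{(i,j),i}`. -/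
def wBar (s : Steps G) (U : State q n G) (d : G.Dart) : Vec q :=
  (1 / 2 : ℝ) • (State.w U d + State.w U d.symm) + (s.kappa (edgeOf d) / 2) •
    (eSign d.fst d.snd • State.u U d.fst + eSign d.snd d.fst • State.u U d.snd)

/-- The prediction `ū_i`. -/
def uBar (g : Game m q n) (s : Steps G) (U : State q n G) (i : Fin m) : Vec q :=
  proj (orthant q) (State.u U i + s.sigma i • (g.A i (State.x U i) - g.b i -
    ∑ d : G.Dart with d.fst = i, eSign d.fst d.snd • wBar s U d))

/-- The prediction `x̄_i`. -/
def xBar (g : Game m q n) (s : Steps G) (U : State q n G) (i : Fin m) : Vec (n i) :=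
  proj (g.localSet i) (State.x U i - s.tau i • (g.partialGrad i (State.x U) +
    ContinuousLinearMap.adjoint (g.A i) (uBar g s U i)))

/-- The operator `T` of one synchronous iteration (prediction followed by correction). -/
def opT (g : Game m q n) (s : Steps G) (U : State q n G) : State q n G :=
  State.mk (xBar g s U)
    (fun i => uBar g s U i + s.sigma i • g.A i (xBar g s U i - State.x U i))
    (fun d => wBar s U d + s.kappa (edgeOf d) •
      (eSign d.fst d.snd • (uBar g s U d.fst - State.u U d.fst)))

/-- `R = Id - T`. -/
def opR (g : Game m q n) (s : Steps G) (U : State q n G) : State q n G := U - opT g s U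

/-- `R_i`, the part of `R` belonging to player `i`. -/
def opRi (g : Game m q n) (s : Steps G) (i : Fin m) (U : State q n G) : State q n G :=
  State.block i (opR g s U)

/-- The delay operator `Φ` on stacked vectors `col{Z_0, …, Z_ε}` (for `ε ≥ 1`), where `S` is
the weight `T_S` and `c` is the constant `√(p_min / κ(T_S))`. -/
def opPhi {E : Type*} [AddCommGroup E] [Module ℝ E] (S : E →ₗ[ℝ] E) (c : ℝ) (ε : ℕ)
    (Z : Fin (ε + 1) → E) (l : Fin (ε + 1)) : E :=
  let z : ℕ → E := fun j => Z (Fin.ofNat (ε + 1) j)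
  let k : ℕ := l
  if k = 0 then S (z 0) + (ε * c) • S (z 0 - z 1)
  else if k = ε then c • S (z ε - z (ε - 1))
  else c • S (((k : ℝ) - ε - 1) • z (k - 1) + (2 * (ε : ℝ) - 2 * k + 1) • z k +
    ((k : ℝ) - ε) • z (k + 1))

/-- `‖Z‖²_Φ = ⟨Z, Φ Z⟩`. -/
def phiNormSq {E : Type*} [NormedAddCommGroup E] [InnerProductSpace ℝ E] (S : E →ₗ[ℝ] E) (c : ℝ)
    (ε : ℕ) (Z : Fin (ε + 1) → E) : ℝ :=
  ∑ l, inner ℝ (Z l) (opPhi S c ε Z l)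

end Operators

/-! ### The asynchronous iteration -/

section Asynchronous

variable {m q : ℕ} {n : Fin m → ℕ} {G : SimpleGraph (Fin m)} {Ω : Type*}

/-- The vector `Û_k` of delayed components: player `i` enters with `x_i` and `u_i` of time
`k - φ_i^k`, edge `(i, j)` with `w_{(i,j)}` of time `k - ϕ_{(i,j)}^k`. The truncated subtraction
implements the convention `U_l = U_0` for `l < 0`. -/
def delayed (U : ℕ → Ω → State q n G) (φ : ℕ → Ω → Fin m → ℕ) (ϕ : ℕ → Ω → G.edgeSet → ℕ)
    (k : ℕ) (ω : Ω) : State q n G :=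
  State.mk (fun i => State.x (U (k - φ k ω i) ω) i) (fun i => State.u (U (k - φ k ω i) ω) i)
    (fun d => State.w (U (k - ϕ k ω (edgeOf d)) ω) d)

/-- The stacked vector `col{U_k, U_{k-1}, …, U_{k-ε}}`, with `U_l = U_0` for `l < 0`. -/
def history {E : Type*} (U : ℕ → Ω → E) (ε k : ℕ) (ω : Ω) : Fin (ε + 1) → E :=
  fun l => U (k - l) ω

/-- The σ-algebra `Z_k` generated by `U_0, U_1, Û_1, …, U_k, Û_k`. -/
@[reducible] def sigmaZ {E : Type*} [TopologicalSpace E] (U V : ℕ → Ω → E) (k : ℕ) : MeasurableSpace Ω :=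
  MeasurableSpace.comap (U 0) (borel E) ⊔
    ⨆ j ∈ Finset.Icc 1 k, MeasurableSpace.comap (U j) (borel E) ⊔
      MeasurableSpace.comap (V j) (borel E)

/-- The σ-algebra generated by the activations `i_0, …, i_{k-1}` and the delays of the
iterations `0, …, k`. If the delays are deterministic, it is generated by the activations. -/
@[reducible] def pastInfo (act : ℕ → Ω → Fin m) (φ : ℕ → Ω → Fin m → ℕ) (ϕ : ℕ → Ω → G.edgeSet → ℕ)
    (k : ℕ) : MeasurableSpace Ω :=
  (⨆ j ∈ Finset.range k, MeasurableSpace.comap (act j) inferInstance) ⊔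
    ⨆ j ∈ Finset.range (k + 1), MeasurableSpace.comap (φ j) inferInstance ⊔
      MeasurableSpace.comap (ϕ j) inferInstance

end Asynchronous

end GNE

end

namespace GNE

/-! ### Projections, subdifferentials of indicators, eigenvalue bounds. -/

section General

variable {E : Type*} [NormedAddCommGroup E] [InnerProductSpace ℝ E]

/-! The proof joins a deterministic cocoercivity estimate to a Lyapunov argument for delayed random
block updates.

Cocoercivity (`half_normSq_opR_le`): for every zero `U*`, half of the squared `T_S`-norm of `R U` is
at most `⟨R U, T_S (U - U*)⟩`. Exact identities per player and per edge (`node_splitting_eq`,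
`edge_splitting_eq`) write the difference as the projection inequalities of the prediction, the
variational inequalities of `U*`, the pairing of `F x - F x*` with `x̄ - x*`, and a quadratic
remainder. As `F` is evaluated at `x` and not at `x̄`, that pairing may be negative, but strong
monotonicity and Lipschitz continuity bound it below by `-L²/(4μ) ‖x - x̄‖²`, which the step-size
conditions absorb.

Lyapunov function: summation by parts (`phiNormSq_eq`) turns the `Φ`-form into the squared distance
to `U*` plus `c` times a sum of squared past increments with weights `ε, ε - 1, …, 1`. One step
later every old weight has dropped by one, which releases `c` times the plain sum of the squared
increments. This pays for the error of evaluating `R` at the delayed point, by Young's inequality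
with a matching parameter. In the mean over the active player, the factors `1/p_i` make the linear
term that of the full operator `R`; the remaining coefficient of `‖R Û_k‖²` is at most `-β η²/m`
(`expected_step_le`).

Probability: there are finitely many players, delays are bounded and `U_0` is fixed, so each iterate
takes finitely many values. Measurability and integrability then need no regularity of `R`, and
independence of `i_k` from the past turns the conditional expectation into the finite mean above
(`condExp_select`). The functional is a nonnegative supermartingale, hence converges almost surely.
-/

theorem proj_spec [CompleteSpace E] {C : Set E} (hne : C.Nonempty) (hcl : IsClosed C)
    (hconv : Convex ℝ C) (x : E) :
    proj C x ∈ C ∧ ∀ z ∈ C, inner ℝ (x - proj C x) (z - proj C x) ≤ 0 := by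
  have hex : ∃ y, y ∈ C ∧ ∀ z ∈ C, ‖y - x‖ ≤ ‖z - x‖ := by
    obtain ⟨y, hy, hmin⟩ := exists_norm_eq_iInf_of_complete_convex hne hcl.isComplete hconv x
    refine ⟨y, hy, fun z hz => ?_⟩
    rw [norm_sub_rev y, norm_sub_rev z, hmin]
    exact ciInf_le ⟨0, by rintro _ ⟨w, rfl⟩; exact norm_nonneg _⟩ (⟨z, hz⟩ : C)
  have hspec : proj C x ∈ C ∧ ∀ z ∈ C, ‖proj C x - x‖ ≤ ‖z - x‖ := Classical.epsilon_spec hex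
  refine ⟨hspec.1, (norm_eq_iInf_iff_real_inner_le_zero hconv hspec.1).1 ?_⟩
  have : Nonempty C := hne.to_subtype
  refine le_antisymm (le_ciInf fun w => ?_) ?_
  · rw [norm_sub_rev, norm_sub_rev x]
    exact hspec.2 w w.2
  · exact ciInf_le ⟨0, by rintro _ ⟨w, rfl⟩; exact norm_nonneg _⟩ (⟨_, hspec.1⟩ : C)

theorem subdiff_indicatorFun {C : Set E} (hne : C.Nonempty) {x v : E}
    (h : v ∈ subdiff (indicatorFun C) x) : x ∈ C ∧ ∀ y ∈ C, inner ℝ v (y - x) ≤ 0 := by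
  have hx : x ∈ C := by
    by_contra hx
    obtain ⟨y, hy⟩ := hne
    have := h y
    simp only [indicatorFun, hx, hy, if_true, if_false] at this
    rw [EReal.top_add_coe] at this
    simp at this
  refine ⟨hx, fun y hy => ?_⟩
  have := h y
  simp only [indicatorFun, hx, hy, if_true, zero_add] at this
  exact_mod_cast this

/-- The conjugate of the indicator function of a subspace is the indicator function of its
orthogonal complement. -/
theorem conjugate_indicatorFun_submodule (C : Submodule ℝ E) (v : E) :
    conjugate (indicatorFun (C : Set E)) v = indicatorFun (Cᗮ : Set E) v := by
  classical
  have key : ∀ x : E, ((inner ℝ v x : ℝ) : EReal) - indicatorFun (C : Set E) x =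
      if x ∈ C then ((inner ℝ v x : ℝ) : EReal) else ⊥ := by
    intro x
    by_cases hx : x ∈ C <;> simp [indicatorFun, hx]
  simp only [conjugate, key]
  by_cases hv : v ∈ Cᗮ
  · simp only [indicatorFun, SetLike.mem_coe, hv, if_true]
    refine le_antisymm (iSup_le fun x => ?_) (le_iSup_of_le 0 (by simp))
    by_cases hx : x ∈ C
    · rw [if_pos hx, real_inner_comm, (Submodule.mem_orthogonal C v).1 hv x hx]; simp
    · simp [hx]
  · simp only [indicatorFun, SetLike.mem_coe, hv, if_false]
    rw [Submodule.mem_orthogonal] at hv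
    push Not at hv
    obtain ⟨x, hx, hne⟩ := hv
    rw [EReal.eq_top_iff_forall_lt]
    intro r
    rw [real_inner_comm] at hne
    -- The multiple of `x` is scaled so that its pairing with `v` equals `r + 1`; hence the supremum
    -- exceeds every real.
    refine lt_of_lt_of_le ?_ (le_iSup _ (((r + 1) / inner ℝ v x) • x))
    rw [if_pos (C.smul_mem _ hx), inner_smul_right, div_mul_cancel₀ _ hne]
    exact_mod_cast lt_add_one r

theorem finite_setOf_hasEigenvalue [FiniteDimensional ℝ E] (L : E →ₗ[ℝ] E) :
    {r : ℝ | Module.End.HasEigenvalue L r}.Finite :=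
  Module.End.finite_hasEigenvalue L

/-- Expand in an orthonormal eigenbasis; the supremum dominates each eigenvalue because the spectrum
is finite. -/
theorem inner_le_eigMax [FiniteDimensional ℝ E] {L : E →ₗ[ℝ] E} (hL : L.IsSymmetric) (x : E) :
    inner ℝ x (L x) ≤ eigMax L * ‖x‖ ^ 2 := by
  set b := hL.eigenvectorBasis rfl with hb
  rw [← b.sum_inner_mul_inner x (L x), ← real_inner_self_eq_norm_sq, ← b.sum_inner_mul_inner x x,
    Finset.mul_sum]
  refine Finset.sum_le_sum fun i _ => ?_
  have h1 : inner ℝ (b i) (L x) = hL.eigenvalues rfl i * inner ℝ (b i) x := by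
    rw [← hL, hb, hL.apply_eigenvectorBasis, inner_smul_left]; simp
  have h2 : hL.eigenvalues rfl i ≤ eigMax L :=
    le_csSup (finite_setOf_hasEigenvalue L).bddAbove (hL.hasEigenvalue_eigenvalues rfl i)
  rw [h1, real_inner_comm x]
  nlinarith [mul_self_nonneg (inner ℝ (b i) x), mul_le_mul_of_nonneg_right h2
    (mul_self_nonneg (inner ℝ (b i) x))]

theorem eigenvalue_nonneg {L : E →ₗ[ℝ] E} (hL : ∀ x, 0 ≤ inner ℝ x (L x)) {r : ℝ}
    (hr : Module.End.HasEigenvalue L r) : 0 ≤ r := by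
  obtain ⟨v, hv⟩ := hr.exists_hasEigenvector
  have h := hL v
  rw [hv.apply_eq_smul, inner_smul_right, real_inner_self_eq_norm_sq] at h
  have : 0 < ‖v‖ ^ 2 := by have := norm_pos_iff.2 hv.2; positivity
  exact nonneg_of_mul_nonneg_left h this

theorem eigMax_nonneg {L : E →ₗ[ℝ] E} (hL : ∀ x, 0 ≤ inner ℝ x (L x)) : 0 ≤ eigMax L :=
  Real.sSup_nonneg fun _ hr => eigenvalue_nonneg hL hr

/-- In a nontrivial space the finite spectrum is nonempty, so the infimum is an eigenvalue, positive
by definiteness. In the zero space the quotient would be `0 / 0 = 0`. -/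
theorem one_le_condNumber [FiniteDimensional ℝ E] [Nontrivial E] {L : E →ₗ[ℝ] E}
    (hL : L.IsSymmetric) (hpos : ∀ x, x ≠ 0 → 0 < inner ℝ x (L x)) : 1 ≤ condNumber L := by
  have hne : {r : ℝ | Module.End.HasEigenvalue L r}.Nonempty :=
    ⟨_, hL.hasEigenvalue_eigenvalues rfl ⟨0, Module.finrank_pos⟩⟩
  have hfin := finite_setOf_hasEigenvalue L
  have hmem : eigMin L ∈ {r : ℝ | Module.End.HasEigenvalue L r} := hne.csInf_mem hfin
  have hmin : 0 < eigMin L := by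
    obtain ⟨v, hv⟩ := Module.End.HasEigenvalue.exists_hasEigenvector hmem
    have h := hpos v hv.2
    rw [hv.apply_eq_smul, inner_smul_right, real_inner_self_eq_norm_sq] at h
    exact pos_of_mul_pos_left h (by positivity)
  rw [condNumber, one_le_div hmin]
  exact le_csSup hfin.bddAbove hmem

theorem norm_sq_le_eigMax {F : Type*} [NormedAddCommGroup F] [InnerProductSpace ℝ F]
    [FiniteDimensional ℝ E] [CompleteSpace E] [CompleteSpace F] (A : E →L[ℝ] F) (x : E) :
    ‖A x‖ ^ 2 ≤ eigMax ((ContinuousLinearMap.adjoint A).comp A).toLinearMap * ‖x‖ ^ 2 := by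
  have h : ∀ y z, inner ℝ y ((ContinuousLinearMap.adjoint A).comp A z) = inner ℝ (A y) (A z) :=
    fun y z => by simp [ContinuousLinearMap.adjoint_inner_right]
  have := inner_le_eigMax (L := ((ContinuousLinearMap.adjoint A).comp A).toLinearMap)
    (fun y z => by
      have := h z y
      rw [real_inner_comm, real_inner_comm (A y)] at this
      exact this.trans (h y z).symm) x
  rw [← real_inner_self_eq_norm_sq]
  exact (h x x).symm.le.trans this

theorem eigMax_adjoint_comp_nonneg {F : Type*} [NormedAddCommGroup F] [InnerProductSpace ℝ F]
    [CompleteSpace E] [CompleteSpace F] (A : E →L[ℝ] F) :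
    0 ≤ eigMax ((ContinuousLinearMap.adjoint A).comp A).toLinearMap :=
  eigMax_nonneg fun x => by
    simp only [ContinuousLinearMap.coe_coe, ContinuousLinearMap.comp_apply,
      ContinuousLinearMap.adjoint_inner_right]
    exact real_inner_self_nonneg

end General

/-! ### The delay functional and the Young estimate for delays. -/

section Phi

/-- The increment of the delay functional along a trajectory. -/
theorem sum_delay_succ {F : Type*} [AddCommGroup F] (ε k : ℕ) (hε : 0 < ε) (N : F → ℝ)
    (z : ℕ → F) :
    ∑ l ∈ Finset.range ε, ((ε : ℝ) - l) * N (z (k + 1 - l) - z (k + 1 - (l + 1))) =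
      ε * N (z (k + 1) - z k) +
        ∑ l ∈ Finset.range ε, ((ε : ℝ) - l) * N (z (k - l) - z (k - (l + 1))) -
        ∑ l ∈ Finset.range ε, N (z (k - l) - z (k - (l + 1))) := by
  obtain ⟨e, rfl⟩ := Nat.exists_eq_succ_of_ne_zero hε.ne'
  rw [Finset.sum_range_succ', add_sub_assoc, ← Finset.sum_sub_distrib, Finset.sum_range_succ,
    add_comm]
  congr 1
  · simp
  · rw [Finset.sum_congr rfl (g := fun l => (((e.succ : ℕ) : ℝ) - l) *
      N (z (k - l) - z (k - (l + 1))) - N (z (k - l) - z (k - (l + 1))))]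
    · simp
    · intro l _
      rw [Nat.add_sub_add_right, Nat.add_sub_add_right]
      push_cast; ring

variable {E : Type*} [NormedAddCommGroup E] [InnerProductSpace ℝ E]

/-- Summation by parts. With `d_l = z_l - z_{l+1}`, row `l ≥ 1` of `Φ z` is `c S ((ε - l) d_l - (ε -
l + 1) d_{l-1})`, so each difference is met by both of its endpoints and forms a square. -/
theorem phiNormSq_eq (S : E →ₗ[ℝ] E) (c : ℝ) {ε : ℕ} (hε : 0 < ε) (z : ℕ → E) :
    phiNormSq S c ε (fun l => z l) = normSq S (z 0) +
      c * ∑ l ∈ Finset.range ε, ((ε : ℝ) - l) * normSq S (z l - z (l + 1)) := by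
  have hz : ∀ j, j ≤ ε → ((Fin.ofNat (ε + 1) j : Fin (ε + 1)) : ℕ) = j := fun j hj =>
    Nat.mod_eq_of_lt (Nat.lt_succ_of_le hj)
  set e : ℕ → ℝ := fun l => ((ε : ℝ) - l) * inner ℝ (z l) (S (z l - z (l + 1))) with he
  set e' : ℕ → ℝ := fun l => ((ε : ℝ) - l) * inner ℝ (z (l + 1)) (S (z l - z (l + 1))) with he'
  -- One formula covers the three cases of `opPhi`. At `l = ε` the weight `ε - l` vanishes, so the
  -- value of `z` at `ε + 1` plays no role.
  have h0 : ∀ l : Fin (ε + 1), inner ℝ (z l) (opPhi S c ε (fun l => z l) l) =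
      (if (l : ℕ) = 0 then normSq S (z 0) else 0) + c * e l -
        (if (l : ℕ) = 0 then 0 else c * e' (l - 1)) := by
    rintro ⟨l, hl⟩
    have hl' : l ≤ ε := Nat.lt_succ_iff.1 hl
    rcases Nat.eq_zero_or_pos l with rfl | hpos
    · simp only [opPhi, if_true, hz 0 (Nat.zero_le _), hz 1 hε, he, normSq, inner_add_right,
        inner_smul_right]
      push_cast; ring
    · have hne : l ≠ 0 := hpos.ne'
      obtain ⟨j, rfl⟩ := Nat.exists_eq_succ_of_ne_zero hne
      by_cases hlε : j + 1 = ε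
      · subst hlε
        simp only [opPhi, Nat.succ_eq_add_one, if_neg (Nat.succ_ne_zero j), if_true, hz _ le_rfl,
          Nat.add_sub_cancel, hz j (Nat.le_succ j), he, he', inner_smul_right, map_sub,
          inner_sub_right]
        push_cast; ring
      · have hlt : j + 1 + 1 ≤ ε := lt_of_le_of_ne hl' hlε
        simp only [opPhi, Nat.succ_eq_add_one, if_neg (Nat.succ_ne_zero j), if_neg hlε,
          Nat.add_sub_cancel, hz j (by omega), hz (j + 1) hl', hz (j + 1 + 1) hlt, he, he',
          inner_smul_right, map_sub, map_add, map_smul, inner_sub_right, inner_add_right]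
        push_cast; ring
  rw [phiNormSq, Finset.sum_congr rfl fun l _ => h0 l]
  rw [Fin.sum_univ_eq_sum_range (fun l => (if l = 0 then normSq S (z 0) else 0) + c * e l -
        (if l = 0 then 0 else c * e' (l - 1))) (ε + 1), Finset.sum_sub_distrib,
    Finset.sum_add_distrib]
  rw [Finset.sum_range_succ' (fun l => if l = 0 then (0 : ℝ) else c * e' (l - 1)),
    Finset.sum_range_succ (fun l => c * e l), Finset.sum_ite_eq' (Finset.range (ε + 1))]
  simp only [Finset.mem_range, Nat.zero_lt_succ, if_true, Nat.succ_ne_zero, if_false,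
    Nat.add_sub_cancel, ← Finset.mul_sum, normSq, inner_sub_left, mul_sub, Finset.sum_sub_distrib]
  simp only [he, he', sub_self, zero_mul, mul_zero, map_sub, add_zero]
  ring

/-- Telescope the delayed difference into at most `ε` increments and apply Young's inequality to
each. Extending the sum from `d` to `ε` terms gives a bound independent of the actual delay. -/
theorem neg_two_inner_delay_le {γ : ℝ} (hγ : 0 < γ) {ε d : ℕ} (hd : d ≤ ε) (k : ℕ) (v : E)
    (z : ℕ → E) : -2 * inner ℝ v (z k - z (k - d)) ≤
      ε / γ * ‖v‖ ^ 2 + γ * ∑ l ∈ Finset.range ε, ‖z (k - l) - z (k - (l + 1))‖ ^ 2 := by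
  have htel : z k - z (k - d) = ∑ l ∈ Finset.range d, (z (k - l) - z (k - (l + 1))) := by
    rw [Finset.sum_range_sub' (fun l => z (k - l))]; simp
  have hone : ∀ w : E, -2 * inner ℝ v w ≤ 1 / γ * ‖v‖ ^ 2 + γ * ‖w‖ ^ 2 := by
    intro w
    have h := sq_nonneg ‖v + γ • w‖
    rw [norm_add_sq_real, inner_smul_right, norm_smul, Real.norm_of_nonneg hγ.le] at h
    have : 1 / γ * (‖v‖ ^ 2 + 2 * (γ * inner ℝ v w) + (γ * ‖w‖) ^ 2) =
      1 / γ * ‖v‖ ^ 2 + 2 * inner ℝ v w + γ * ‖w‖ ^ 2 := by field_simp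
    have h2 := mul_nonneg (one_div_nonneg.2 hγ.le) h
    linarith
  rw [htel, inner_sum, Finset.mul_sum]
  calc _ ≤ ∑ l ∈ Finset.range d,
        (1 / γ * ‖v‖ ^ 2 + γ * ‖z (k - l) - z (k - (l + 1))‖ ^ 2) :=
        Finset.sum_le_sum fun l _ => hone _
    _ ≤ ∑ l ∈ Finset.range ε, (1 / γ * ‖v‖ ^ 2 + γ * ‖z (k - l) - z (k - (l + 1))‖ ^ 2) :=
        Finset.sum_le_sum_of_subset_of_nonneg (Finset.range_mono hd) fun _ _ _ => by positivity
    _ = _ := by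
        rw [Finset.sum_add_distrib, Finset.sum_const, Finset.card_range, ← Finset.mul_sum]
        simp only [nsmul_eq_mul]; ring

end Phi

/-! ### Algebraic identities for one player and one edge. -/

section AbstractSplitting

variable {E V : Type*} [NormedAddCommGroup E] [InnerProductSpace ℝ E] [CompleteSpace E]
  [NormedAddCommGroup V] [InnerProductSpace ℝ V] [CompleteSpace V]

/-- With the correction `σ A (x̄ - x)` in the multiplier, all cross terms sort into optimality
residuals at the prediction and at the zero, a monotonicity pairing, the edge coupling, and a
remainder of pure squares. -/
theorem node_splitting_eq (A : E →L[ℝ] V) {τ σ : ℝ} (hσ : σ ≠ 0) (x xs xb F Fs : E)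
    (u us ub h hs b : V) :
    τ⁻¹ * inner ℝ (x - xb) (x - xs) +
        σ⁻¹ * inner ℝ (u - (ub + σ • A (xb - x))) (u - us) -
        1 / 2 * (τ⁻¹ * ‖x - xb‖ ^ 2 + σ⁻¹ * ‖u - (ub + σ • A (xb - x))‖ ^ 2) =
      inner ℝ (τ⁻¹ • (x - xb) - (F + ContinuousLinearMap.adjoint A ub)) (xb - xs) +
      inner ℝ (Fs + ContinuousLinearMap.adjoint A us) (xb - xs) +
      inner ℝ (σ⁻¹ • (u - ub) + (A x - b - h)) (ub - us) +
      inner ℝ (-A xs + hs + b) (ub - us) +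
      inner ℝ (F - Fs) (xb - xs) + inner ℝ (h - hs) (ub - us) +
      1 / 2 * (τ⁻¹ * ‖x - xb‖ ^ 2 - σ * ‖A (x - xb)‖ ^ 2 + σ⁻¹ * ‖u - ub‖ ^ 2) := by
  have hadj : ∀ y z, inner ℝ (ContinuousLinearMap.adjoint A y) z = inner ℝ (A z) y := fun y z => by
    rw [ContinuousLinearMap.adjoint_inner_left, real_inner_comm]
  obtain ⟨a, rfl⟩ : ∃ a, x = xb + a := ⟨x - xb, by abel⟩
  obtain ⟨X, rfl⟩ : ∃ X, xb = xs + X := ⟨xb - xs, by abel⟩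
  obtain ⟨r, rfl⟩ : ∃ r, u = ub + r := ⟨u - ub, by abel⟩
  obtain ⟨Y, rfl⟩ : ∃ Y, ub = us + Y := ⟨ub - us, by abel⟩
  have e1 : xs + X + a - (xs + X) = a := by abel
  have e2 : xs + X + a - xs = X + a := by abel
  have e3 : us + Y + r - (us + Y) = r := by abel
  have e4 : us + Y + r - us = Y + r := by abel
  have e5 : us + Y + r - (us + Y + σ • A (xs + X - (xs + X + a))) = r + σ • A a := by
    rw [show xs + X - (xs + X + a) = -a by abel, map_neg, smul_neg]; abel
  rw [e1, e2, e3, e4, e5, add_sub_cancel_left, add_sub_cancel_left]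
  simp only [← real_inner_self_eq_norm_sq, inner_add_left, inner_add_right, inner_sub_left,
    inner_smul_left, inner_smul_right, inner_neg_left, hadj, map_add, RCLike.conj_to_real,
    real_inner_comm r (A a), real_inner_comm Y (A _), real_inner_comm us (A _)]
  rw [real_inner_comm (A a) Y, real_inner_comm (A a) r]
  field_simp
  ring

omit [CompleteSpace V] in
-- Edge counterpart of the identity above: the coupling appears with the opposite sign, to cancel
-- against the players, and the correction costs `κ ‖u - ū‖²`.
theorem edge_splitting_eq {κ e : ℝ} (hκ : κ ≠ 0) (he : e * e = 1) (u us ub w ws wb : V) :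
    κ⁻¹ * inner ℝ (w - (wb + κ • e • (ub - u))) (w - ws) -
        1 / 2 * (κ⁻¹ * ‖w - (wb + κ • e • (ub - u))‖ ^ 2) =
      inner ℝ (κ⁻¹ • (w - wb) + e • u) (wb - ws) - inner ℝ (e • us) (wb - ws) -
      e * inner ℝ (wb - ws) (ub - us) +
      1 / 2 * (κ⁻¹ * ‖w - wb‖ ^ 2 - κ * ‖u - ub‖ ^ 2) := by
  obtain ⟨v, rfl⟩ : ∃ v, w = wb + v := ⟨w - wb, by abel⟩
  obtain ⟨W, rfl⟩ : ∃ W, wb = ws + W := ⟨wb - ws, by abel⟩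
  obtain ⟨r, rfl⟩ : ∃ r, u = ub + r := ⟨u - ub, by abel⟩
  obtain ⟨Y, rfl⟩ : ∃ Y, ub = us + Y := ⟨ub - us, by abel⟩
  have e1 : ws + W + v - (ws + W) = v := by abel
  have e2 : ws + W + v - ws = W + v := by abel
  have e3 : us + Y + r - (us + Y) = r := by abel
  have e5 : ws + W + v - (ws + W + κ • e • (us + Y - (us + Y + r))) = v + (κ * e) • r := by
    rw [show us + Y - (us + Y + r) = -r by abel, smul_neg, smul_neg, smul_smul]; abel
  rw [e1, e2, e3, e5, add_sub_cancel_left, add_sub_cancel_left]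
  simp only [← real_inner_self_eq_norm_sq, inner_add_left, inner_add_right,
    inner_smul_left, inner_smul_right, RCLike.conj_to_real]
  rw [real_inner_comm v r, real_inner_comm W Y]
  field_simp
  linear_combination (-κ ^ 2 * inner ℝ r r) * he

end AbstractSplitting

theorem add_sq_bound {μ L a X : ℝ} (hμ : 0 < μ) :
    0 ≤ μ * X ^ 2 - L * X * a + L ^ 2 / (4 * μ) * a ^ 2 := by
  have : μ * X ^ 2 - L * X * a + L ^ 2 / (4 * μ) * a ^ 2 = (2 * μ * X - L * a) ^ 2 / (4 * μ) := by
    field_simp; ring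
  rw [this]; positivity

/-! ### Block structure of the state space and the consensus subspace. -/

section StateLemmas

variable {m q : ℕ} {n : Fin m → ℕ} {G : SimpleGraph (Fin m)}

theorem State.ext {U V : State q n G} (hx : ∀ i, State.x U i = State.x V i)
    (hu : ∀ i, State.u U i = State.u V i) (hw : ∀ d, State.w U d = State.w V d) : U = V := by
  obtain ⟨⟨x, ⟨u, w⟩⟩⟩ := U
  obtain ⟨⟨x', ⟨u', w'⟩⟩⟩ := V
  have h1 : x = x' := PiLp.ext hx
  have h2 : u = u' := PiLp.ext hu
  have h3 : w = w' := PiLp.ext hw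
  subst h1 h2 h3; rfl

@[simp] theorem State.x_mk (x : ∀ i, Vec (n i)) (u : Fin m → Vec q) (w : G.Dart → Vec q) (i) :
    State.x (State.mk x u w) i = x i := rfl
@[simp] theorem State.u_mk (x : ∀ i, Vec (n i)) (u : Fin m → Vec q) (w : G.Dart → Vec q) (i) :
    State.u (State.mk x u w) i = u i := rfl
@[simp] theorem State.w_mk (x : ∀ i, Vec (n i)) (u : Fin m → Vec q) (w : G.Dart → Vec q) (d) :
    State.w (State.mk x u w) d = w d := rfl
@[simp] theorem State.x_sub (U V : State q n G) : State.x (U - V) = State.x U - State.x V := rfl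
@[simp] theorem State.u_sub (U V : State q n G) : State.u (U - V) = State.u U - State.u V := rfl
@[simp] theorem State.w_sub (U V : State q n G) : State.w (U - V) = State.w U - State.w V := rfl
@[simp] theorem State.x_zero : State.x (0 : State q n G) = 0 := rfl
@[simp] theorem State.u_zero : State.u (0 : State q n G) = 0 := rfl
@[simp] theorem State.w_zero : State.w (0 : State q n G) = 0 := rfl

theorem edgeOf_symm (d : G.Dart) : edgeOf d.symm = edgeOf d :=
  Subtype.ext d.edge_symm

theorem eSign_mul_self (i j : Fin m) : eSign i j * eSign i j = 1 := by
  unfold eSign; split_ifs <;> norm_num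

variable [DecidableRel G.Adj]

theorem State.inner_eq (U V : State q n G) : inner ℝ U V =
    ∑ i, inner ℝ (State.x U i) (State.x V i) + (∑ i, inner ℝ (State.u U i) (State.u V i) +
      ∑ d, inner ℝ (State.w U d) (State.w V d)) := by
  rw [WithLp.prod_inner_apply, WithLp.prod_inner_apply, PiLp.inner_apply, PiLp.inner_apply,
    PiLp.inner_apply]
  rfl

theorem inner_opTS (s : Steps G) (U V : State q n G) : inner ℝ U (opTS q n s V) =
    ∑ i, (s.tau i)⁻¹ * inner ℝ (State.x U i) (State.x V i) +
      (∑ i, (s.sigma i)⁻¹ * inner ℝ (State.u U i) (State.u V i) +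
      ∑ d, (s.kappa (edgeOf d))⁻¹ * inner ℝ (State.w U d) (State.w V d)) := by
  rw [State.inner_eq]
  simp only [opTS, LinearMap.coe_mk, AddHom.coe_mk, State.x_mk, State.u_mk, State.w_mk,
    inner_smul_right]

theorem normSq_opTS (s : Steps G) (U : State q n G) : normSq (opTS q n s) U =
    ∑ i, (s.tau i)⁻¹ * ‖State.x U i‖ ^ 2 + (∑ i, (s.sigma i)⁻¹ * ‖State.u U i‖ ^ 2 +
      ∑ d, (s.kappa (edgeOf d))⁻¹ * ‖State.w U d‖ ^ 2) := by
  rw [normSq, inner_opTS]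
  simp only [real_inner_self_eq_norm_sq]

theorem opTS_symm (s : Steps G) (U V : State q n G) :
    inner ℝ U (opTS q n s V) = inner ℝ V (opTS q n s U) := by
  rw [inner_opTS, inner_opTS]
  simp only [real_inner_comm]

theorem opTS_isSymmetric (s : Steps G) : (opTS q n s).IsSymmetric := fun U V => by
  rw [real_inner_comm, opTS_symm]

/-- The consensus set as a subspace. -/
def consensusSubmodule (q : ℕ) (G : SimpleGraph (Fin m)) [DecidableRel G.Adj] :
    Submodule ℝ (EdgeVar q G) where
  carrier := consensusSet q G
  add_mem' {a b} ha hb d := by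
    have h1 := ha d; have h2 := hb d
    simp only [PiLp.add_apply]
    rw [add_add_add_comm, h1, h2, add_zero]
  zero_mem' d := by simp
  smul_mem' c a ha d := by
    have h1 := ha d
    simp only [PiLp.smul_apply]
    rw [← smul_add, h1, smul_zero]

/-- Reversing darts keeps `z` and negates elements of the consensus space, so the pairing equals its
own negative. -/
theorem mem_orthogonal_consensus {z : EdgeVar q G} (hz : ∀ d : G.Dart, z d.symm = z d) :
    z ∈ (consensusSubmodule q G)ᗮ := by
  rw [Submodule.mem_orthogonal]
  intro y hy
  rw [PiLp.inner_apply]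
  have hinv : ∑ d : G.Dart, inner ℝ (y d.symm) (z d.symm) = ∑ d, inner ℝ (y d) (z d) :=
    Equiv.sum_comp (SimpleGraph.Dart.symm_involutive.toPerm) fun d => inner ℝ (y d) (z d)
  have hneg : ∑ d : G.Dart, inner ℝ (y d.symm) (z d.symm) = -∑ d, inner ℝ (y d) (z d) := by
    rw [← Finset.sum_neg_distrib]
    refine Finset.sum_congr rfl fun d _ => ?_
    rw [hz, eq_neg_of_add_eq_zero_right (hy d), inner_neg_left]
  linarith

theorem sum_dart_fiberwise (f : G.Dart → ℝ) :
    ∑ i, ∑ d : G.Dart with d.fst = i, f d = ∑ d, f d :=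
  Finset.sum_fiberwise _ _ _

end StateLemmas

/-! ### Cocoercivity of `R` at the zeros. -/

section Quasi

variable {m q : ℕ} {n : Fin m → ℕ} {G : SimpleGraph (Fin m)}

theorem wBar_symm (s : Steps G) (U : State q n G) (d : G.Dart) :
    wBar s U d.symm = wBar s U d := by
  simp only [wBar, edgeOf_symm, SimpleGraph.Dart.symm_symm]
  rw [add_comm (State.w U d.symm)]
  congr 2
  exact add_comm _ _

variable [DecidableRel G.Adj]

/-- This and the next two lemmas turn the inclusion at a zero into variational inequalities, one for
each variable. -/
theorem zeros_strategy {g : Game m q n} (hg : g.Regular) {U : State q n G} (hU : U ∈ zeros g G) :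
    State.x U ∈ g.productSet ∧ ∀ y ∈ g.productSet, 0 ≤ ∑ i, inner ℝ
      (g.partialGrad i (State.x U) + ContinuousLinearMap.adjoint (g.A i) (State.u U i))
      (y i - State.x U i) := by
  obtain ⟨V, ⟨hV, -, -⟩, h0⟩ := hU
  obtain ⟨x₀, hx₀⟩ := hg.feasible_nonempty
  obtain ⟨hmem, h⟩ := subdiff_indicatorFun ⟨x₀, hx₀.1⟩ hV
  refine ⟨hmem, fun y hy => ?_⟩
  have h1 := h y hy
  rw [PiLp.inner_apply] at h1
  rw [← neg_nonpos, ← Finset.sum_neg_distrib]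
  refine le_trans (Finset.sum_le_sum fun i _ => ?_) h1
  have h2 : State.x V i + ContinuousLinearMap.adjoint (g.A i) (State.u U i) +
      g.partialGrad i (State.x U) = 0 := congrArg (fun W : State q n G => State.x W i) h0
  rw [← inner_neg_left, PiLp.sub_apply,
    show State.x V i = -(g.partialGrad i (State.x U) +
      ContinuousLinearMap.adjoint (g.A i) (State.u U i)) from
      eq_neg_of_add_eq_zero_left (by rw [← h2]; abel)]

theorem zeros_multiplier {g : Game m q n} {U : State q n G} (hU : U ∈ zeros g G) :
    State.u U ∈ multiplierSet m q ∧ ∀ y ∈ multiplierSet m q, 0 ≤ ∑ i, inner ℝ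
      (-g.A i (State.x U i) + (∑ d : G.Dart with d.fst = i, eSign d.fst d.snd • State.w U d) +
        g.b i) (y i - State.u U i) := by
  obtain ⟨V, ⟨-, hV, -⟩, h0⟩ := hU
  obtain ⟨hmem, h⟩ := subdiff_indicatorFun (C := multiplierSet m q)
    ⟨0, fun i r => by simp⟩ hV
  refine ⟨hmem, fun y hy => ?_⟩
  have h1 := h y hy
  rw [PiLp.inner_apply] at h1
  rw [← neg_nonpos, ← Finset.sum_neg_distrib]
  refine le_trans (Finset.sum_le_sum fun i _ => ?_) h1
  have h2 : State.u V i + (-g.A i (State.x U i) +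
      ∑ d : G.Dart with d.fst = i, eSign d.fst d.snd • State.w U d) + g.b i = 0 :=
    congrArg (fun W : State q n G => State.u W i) h0
  rw [← inner_neg_left, PiLp.sub_apply, eq_neg_of_add_eq_zero_left ((add_assoc _ _ _).symm.trans h2)]

/-- The conjugate of the indicator of the consensus space is the indicator of its orthogonal
complement, so the edge inclusion is again a normal-cone condition. -/
theorem zeros_edge {g : Game m q n} {U : State q n G} (hU : U ∈ zeros g G) :
    State.w U ∈ (consensusSubmodule q G)ᗮ ∧ ∀ y ∈ (consensusSubmodule q G)ᗮ,
      ∑ d : G.Dart, inner ℝ (eSign d.fst d.snd • State.u U d.fst) (y d - State.w U d) ≤ 0 := by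
  obtain ⟨V, ⟨-, -, hV⟩, h0⟩ := hU
  have hc : conjugate (indicatorFun (consensusSet q G)) =
      indicatorFun ((consensusSubmodule q G)ᗮ : Set (EdgeVar q G)) :=
    funext fun v => conjugate_indicatorFun_submodule (consensusSubmodule q G) v
  rw [hc] at hV
  obtain ⟨hmem, h⟩ := subdiff_indicatorFun ⟨0, Submodule.zero_mem _⟩ hV
  refine ⟨hmem, fun y hy => ?_⟩
  have h1 := h y hy
  rw [PiLp.inner_apply] at h1
  refine le_trans (Finset.sum_le_sum fun d _ => ?_) h1
  have h2 : State.w V d + -(eSign d.fst d.snd • State.u U d.fst) + 0 = 0 :=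
    congrArg (fun W : State q n G => State.w W d) h0
  rw [add_zero, add_neg_eq_zero] at h2
  rw [PiLp.sub_apply, h2]

/-- The vector `w̄` averages `w + κ Π u` over the two ends of each edge; what is left is
antisymmetric under reversal. -/
theorem wBar_residual_mem {s : Steps G} (hκ : ∀ e, 0 < s.kappa e) (U : State q n G) :
    (WithLp.toLp 2 fun d : G.Dart => (s.kappa (edgeOf d))⁻¹ • (State.w U d - wBar s U d) +
      eSign d.fst d.snd • State.u U d.fst : EdgeVar q G) ∈ consensusSubmodule q G := by
  intro d
  have hk := (hκ (edgeOf d)).ne'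
  simp only [wBar_symm, edgeOf_symm]
  simp only [wBar]
  rw [show d.symm.fst = d.snd from rfl, show d.symm.snd = d.fst from rfl]
  match_scalars <;> field_simp <;> ring

theorem sum_inner_wBar {s : Steps G} (hκ : ∀ e, 0 < s.kappa e) (U : State q n G)
    {y : EdgeVar q G} (hy : y ∈ (consensusSubmodule q G)ᗮ) :
    ∑ d : G.Dart, inner ℝ ((s.kappa (edgeOf d))⁻¹ • (State.w U d - wBar s U d) +
      eSign d.fst d.snd • State.u U d.fst) (wBar s U d - y d) = 0 := by
  have hw : (WithLp.toLp 2 (wBar s U) : EdgeVar q G) ∈ (consensusSubmodule q G)ᗮ :=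
    mem_orthogonal_consensus fun d => wBar_symm s U d
  have := (Submodule.mem_orthogonal _ _).1 (Submodule.sub_mem _ hw hy) _ (wBar_residual_mem hκ U)
  rw [PiLp.inner_apply] at this
  exact this

theorem isClosed_orthant (q : ℕ) : IsClosed (orthant q) := by
  have : orthant q = ⋂ r, {v : Vec q | 0 ≤ v r} := by ext; simp [orthant]
  rw [this]
  exact isClosed_iInter fun r => isClosed_le continuous_const (by fun_prop)

theorem convex_orthant (q : ℕ) : Convex ℝ (orthant q) := by
  intro x hx y hy a b ha hb _ r
  have := mul_nonneg ha (hx r); have := mul_nonneg hb (hy r)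
  simp only [PiLp.add_apply, PiLp.smul_apply, smul_eq_mul]
  linarith

theorem orthant_nonempty (q : ℕ) : (orthant q).Nonempty := ⟨0, fun r => by simp⟩

/-- This weak form suffices: it lets `σ⁻¹ ‖u - ū‖²` dominate the cost of the edge corrections. -/
theorem Steps.Admissible.sigma_mul_kappaSum_le {s : Steps G} {g : Game m q n} {L μ : ℝ}
    {α : Fin m → ℝ} (hs : s.Admissible g L μ α) (i : Fin m) : s.sigma i * s.kappaSum i ≤ 1 := by
  have h1 := hs.sigma_lt i
  have h2 := hs.alpha_pos i; have h3 := hs.alpha_lt_one i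
  nlinarith

theorem Steps.kappaSum_nonneg {s : Steps G} (h : ∀ e, 0 < s.kappa e) (i : Fin m) :
    0 ≤ s.kappaSum i :=
  Finset.sum_nonneg fun _ _ => (h _).le

/-- Exactly what makes the coefficient of `‖x - x̄‖²` nonnegative in the cocoercivity estimate; it
follows after cancelling one factor `1 - α_i`. -/
theorem Steps.Admissible.tau_le {s : Steps G} {g : Game m q n} {L μ : ℝ}
    {α : Fin m → ℝ} (hs : s.Admissible g L μ α) (hμ : 0 < μ) (i : Fin m) :
    s.tau i * (L ^ 2 + 2 * μ * s.sigma i *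
      eigMax ((ContinuousLinearMap.adjoint (g.A i)).comp (g.A i)).toLinearMap) ≤ 2 * μ := by
  have h := hs.tau_lt i
  have h2 := hs.alpha_pos i
  have h3 : 0 < 1 - α i := sub_pos.2 (hs.alpha_lt_one i)
  set Λ := eigMax ((ContinuousLinearMap.adjoint (g.A i)).comp (g.A i)).toLinearMap
  have hΛ : 0 ≤ Λ := eigMax_adjoint_comp_nonneg (g.A i)
  have hk := Steps.kappaSum_nonneg hs.kappa_pos i
  have hσ := hs.sigma_pos i
  have hτ := hs.tau_pos i
  have h5 : 2 * μ * s.sigma i * Λ * (1 - α i) ≤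
      8 * μ * s.sigma i * (1 + s.sigma i * s.kappaSum i) * Λ := by
    have : 0 ≤ μ * s.sigma i * Λ := by positivity
    have h7 : 0 ≤ s.sigma i * s.kappaSum i := by positivity
    nlinarith [mul_nonneg this h7, mul_nonneg this h2.le]
  have h6 : s.tau i * (L ^ 2 + 2 * μ * s.sigma i * Λ) * (1 - α i) ≤ 2 * μ * (1 - α i) ^ 2 := by
    have := mul_le_mul_of_nonneg_left h5 hτ.le
    nlinarith
  have h8 : s.tau i * (L ^ 2 + 2 * μ * s.sigma i * Λ) ≤ 2 * μ * (1 - α i) := by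
    refine le_of_mul_le_mul_right (h6.trans_eq ?_) h3
    ring
  nlinarith

/-- Split `x̄ - x*` as `(x - x*) - (x - x̄)`: strong monotonicity controls the first part, the
Lipschitz bound the second, and completing the square removes `‖x - x*‖`. -/
theorem monotone_part_bound {g : Game m q n} {L μ : ℝ} (hF : g.PseudoGradRegular L μ)
    (x xs : Profile n) (xb : ∀ i, Vec (n i)) :
    -(L ^ 2 / (4 * μ)) * ∑ i, ‖x i - xb i‖ ^ 2 ≤
      ∑ i, inner ℝ (g.partialGrad i x - g.partialGrad i xs) (xb i - xs i) := by
  set a : Profile n := x - WithLp.toLp 2 xb with ha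
  have h1 : ∑ i, ‖x i - xb i‖ ^ 2 = ‖a‖ ^ 2 := by rw [PiLp.norm_sq_eq_of_L2]; rfl
  have h2 : ∑ i, inner ℝ (g.partialGrad i x - g.partialGrad i xs) (xb i - xs i) =
      inner ℝ (g.pseudoGrad x - g.pseudoGrad xs) (x - xs) -
        inner ℝ (g.pseudoGrad x - g.pseudoGrad xs) a := by
    rw [← inner_sub_right, PiLp.inner_apply]
    refine Finset.sum_congr rfl fun i _ => ?_
    have : (x - xs - a) i = xb i - xs i := by simp [ha]
    rw [this]; rfl
  rw [h1, h2]
  have h3 := hF.strongMono x xs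
  have h4 := (real_inner_le_norm (g.pseudoGrad x - g.pseudoGrad xs) a).trans
    (mul_le_mul_of_nonneg_right (hF.lipschitz x xs) (norm_nonneg a))
  have h5 := add_sq_bound (L := L) (a := ‖a‖) (X := ‖x - xs‖) hF.mu_pos
  rw [real_inner_comm] at h3
  linarith

/-- The operator `R` is `1/2`-cocoercive in the `T_S` metric with respect to the zeros of
`T_A + T_M + T_C`. -/
theorem half_normSq_opR_le {g : Game m q n} (hg : g.Regular) {L μ : ℝ}
    (hF : g.PseudoGradRegular L μ) {s : Steps G} {α : Fin m → ℝ} (hs : s.Admissible g L μ α)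
    {Us : State q n G} (hUs : Us ∈ zeros g G) (U : State q n G) :
    1 / 2 * normSq (opTS q n s) (opR g s U) ≤ inner ℝ (opR g s U) (opTS q n s (U - Us)) := by
  have hx : ∀ i, xBar g s U i ∈ g.localSet i ∧ ∀ y ∈ g.localSet i, inner ℝ
      (State.x U i - s.tau i • (g.partialGrad i (State.x U) +
        ContinuousLinearMap.adjoint (g.A i) (uBar g s U i)) - xBar g s U i)
      (y - xBar g s U i) ≤ 0 := fun i =>
    proj_spec (hg.nonempty i) (hg.compact i).isClosed (hg.convex i) _
  have hu : ∀ i, uBar g s U i ∈ orthant q ∧ ∀ y ∈ orthant q, inner ℝ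
      (State.u U i + s.sigma i • (g.A i (State.x U i) - g.b i -
        ∑ d : G.Dart with d.fst = i, eSign d.fst d.snd • wBar s U d) - uBar g s U i)
      (y - uBar g s U i) ≤ 0 := fun i =>
    proj_spec (orthant_nonempty q) (isClosed_orthant q) (convex_orthant q) _
  obtain ⟨hxs, hxs'⟩ := zeros_strategy hg hUs
  obtain ⟨hus, hus'⟩ := zeros_multiplier hUs
  obtain ⟨hws, hws'⟩ := zeros_edge hUs
  have c1 : 0 ≤ ∑ i, inner ℝ ((s.tau i)⁻¹ • (State.x U i - xBar g s U i) -
      (g.partialGrad i (State.x U) + ContinuousLinearMap.adjoint (g.A i) (uBar g s U i)))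
      (xBar g s U i - State.x Us i) := by
    refine Finset.sum_nonneg fun i _ => ?_
    have h := (hx i).2 _ (hxs i)
    have hτ := hs.tau_pos i
    rw [← neg_sub _ (State.x Us i), inner_neg_right, neg_nonpos] at h
    refine nonneg_of_mul_nonneg_right ?_ hτ
    rw [← real_inner_smul_left, smul_sub, smul_inv_smul₀ hτ.ne', sub_right_comm]
    exact h
  have c2 := hxs' (WithLp.toLp 2 (xBar g s U)) fun i => (hx i).1
  have c3 : 0 ≤ ∑ i, inner ℝ ((s.sigma i)⁻¹ • (State.u U i - uBar g s U i) +
      (g.A i (State.x U i) - g.b i -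
        ∑ d : G.Dart with d.fst = i, eSign d.fst d.snd • wBar s U d))
      (uBar g s U i - State.u Us i) := by
    refine Finset.sum_nonneg fun i _ => ?_
    have h := (hu i).2 _ (hus i)
    have hσ := hs.sigma_pos i
    rw [← neg_sub _ (State.u Us i), inner_neg_right, neg_nonpos] at h
    refine nonneg_of_mul_nonneg_right ?_ hσ
    rw [← real_inner_smul_left, smul_add, smul_inv_smul₀ hσ.ne', sub_add_eq_add_sub]
    exact h
  have c4 := hus' (WithLp.toLp 2 (uBar g s U)) fun i => (hu i).1
  have c5 := sum_inner_wBar hs.kappa_pos U hws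
  have c6 := hws' (WithLp.toLp 2 (wBar s U)) (mem_orthogonal_consensus fun d => wBar_symm s U d)
  have c7 := monotone_part_bound hF (State.x U) (State.x Us) (xBar g s U)
  have c8 : ∑ i, inner ℝ ((∑ d : G.Dart with d.fst = i, eSign d.fst d.snd • wBar s U d) -
      ∑ d : G.Dart with d.fst = i, eSign d.fst d.snd • State.w Us d)
      (uBar g s U i - State.u Us i) = ∑ d : G.Dart, eSign d.fst d.snd *
        inner ℝ (wBar s U d - State.w Us d) (uBar g s U d.fst - State.u Us d.fst) := by
    rw [← sum_dart_fiberwise]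
    refine Finset.sum_congr rfl fun i _ => ?_
    rw [← Finset.sum_sub_distrib, sum_inner]
    refine Finset.sum_congr rfl fun d hd => ?_
    rw [← smul_sub, real_inner_smul_left, (Finset.mem_filter.1 hd).2]
  have c9 : ∑ d : G.Dart, s.kappa (edgeOf d) * ‖State.u U d.fst - uBar g s U d.fst‖ ^ 2 =
      ∑ i, s.kappaSum i * ‖State.u U i - uBar g s U i‖ ^ 2 := by
    rw [← sum_dart_fiberwise]
    refine Finset.sum_congr rfl fun i _ => ?_
    rw [Steps.kappaSum, Finset.sum_mul]
    exact Finset.sum_congr rfl fun d hd => by rw [(Finset.mem_filter.1 hd).2]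
  have c10 : 0 ≤ ∑ i, (1 / 2 * ((s.tau i)⁻¹ * ‖State.x U i - xBar g s U i‖ ^ 2 -
      s.sigma i * ‖g.A i (State.x U i - xBar g s U i)‖ ^ 2) -
      L ^ 2 / (4 * μ) * ‖State.x U i - xBar g s U i‖ ^ 2) := by
    refine Finset.sum_nonneg fun i _ => ?_
    have hτ := hs.tau_pos i
    have hμ := hF.mu_pos
    have h1 := mul_le_mul_of_nonneg_left
      (norm_sq_le_eigMax (g.A i) (State.x U i - xBar g s U i)) (hs.sigma_pos i).le
    have h2 := hs.tau_le hμ i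
    set Λ := eigMax ((ContinuousLinearMap.adjoint (g.A i)).comp (g.A i)).toLinearMap
    have h3 : 0 ≤ 1 / 2 * ((s.tau i)⁻¹ - s.sigma i * Λ) - L ^ 2 / (4 * μ) := by
      have : 1 / 2 * ((s.tau i)⁻¹ - s.sigma i * Λ) - L ^ 2 / (4 * μ) =
          (2 * μ - s.tau i * (L ^ 2 + 2 * μ * s.sigma i * Λ)) / (4 * μ * s.tau i) := by
        field_simp; ring
      rw [this]
      exact div_nonneg (sub_nonneg.2 h2) (by positivity)
    have h4 := mul_nonneg h3 (sq_nonneg ‖State.x U i - xBar g s U i‖)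
    linarith
  have c11 : 0 ≤ ∑ i, 1 / 2 * ((s.sigma i)⁻¹ * ‖State.u U i - uBar g s U i‖ ^ 2 -
      s.kappaSum i * ‖State.u U i - uBar g s U i‖ ^ 2) := by
    refine Finset.sum_nonneg fun i _ => ?_
    have hσ := hs.sigma_pos i
    have : s.kappaSum i ≤ (s.sigma i)⁻¹ := by
      rw [← one_div, le_div_iff₀ hσ, mul_comm]
      exact hs.sigma_mul_kappaSum_le i
    have := mul_le_mul_of_nonneg_right this (sq_nonneg ‖State.u U i - uBar g s U i‖)
    linarith
  have c12 : 0 ≤ ∑ d : G.Dart, (s.kappa (edgeOf d))⁻¹ * ‖State.w U d - wBar s U d‖ ^ 2 :=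
    Finset.sum_nonneg fun d _ => by have := hs.kappa_pos (edgeOf d); positivity
  -- Sum the identities over players and edges. By `c8` the coupling terms cancel; by `c9` the edge
  -- costs regroup at the players, where `c11` absorbs them.
  have hnode := Finset.sum_congr (rfl : (Finset.univ : Finset (Fin m)) = Finset.univ)
    fun i _ => node_splitting_eq (g.A i) (τ := s.tau i) (hs.sigma_pos i).ne' (State.x U i)
      (State.x Us i) (xBar g s U i) (g.partialGrad i (State.x U)) (g.partialGrad i (State.x Us))
      (State.u U i) (State.u Us i) (uBar g s U i)
      (∑ d : G.Dart with d.fst = i, eSign d.fst d.snd • wBar s U d)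
      (∑ d : G.Dart with d.fst = i, eSign d.fst d.snd • State.w Us d) (g.b i)
  have hedge := Finset.sum_congr (rfl : (Finset.univ : Finset G.Dart) = Finset.univ)
    fun d _ => edge_splitting_eq (hs.kappa_pos (edgeOf d)).ne' (eSign_mul_self d.fst d.snd)
      (State.u U d.fst) (State.u Us d.fst) (uBar g s U d.fst) (State.w U d) (State.w Us d)
      (wBar s U d)
  rw [normSq_opTS, inner_opTS]
  simp only [opR, opT, State.x_sub, State.u_sub, State.w_sub, PiLp.sub_apply, State.x_mk,
    State.u_mk, State.w_mk]
  simp only [Finset.sum_add_distrib, Finset.sum_sub_distrib, ← Finset.mul_sum, mul_add, mul_sub]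
    at hnode hedge c2 c4 c6 c7 c8 c9 c10 c11 c12 ⊢
  linarith

end Quasi

section NormSq

variable {E : Type*} [NormedAddCommGroup E] [InnerProductSpace ℝ E]

theorem normSq_smul (S : E →ₗ[ℝ] E) (t : ℝ) (x : E) : normSq S (t • x) = t ^ 2 * normSq S x := by
  simp only [normSq, map_smul, inner_smul_left, inner_smul_right, RCLike.conj_to_real]; ring

theorem normSq_neg (S : E →ₗ[ℝ] E) (x : E) : normSq S (-x) = normSq S x := by
  simp [normSq]

theorem normSq_sub {S : E →ₗ[ℝ] E} (hS : ∀ x y, inner ℝ x (S y) = inner ℝ y (S x)) (x y : E) :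
    normSq S (x - y) = normSq S x - 2 * inner ℝ y (S x) + normSq S y := by
  simp only [normSq, map_sub, inner_sub_left, inner_sub_right, hS x y]; ring

end NormSq

/-! ### Expected decrease of the delay functional. -/

section Descent

variable {m q : ℕ} {n : Fin m → ℕ} {G : SimpleGraph (Fin m)} [DecidableRel G.Adj]

/-- All step-sizes and edge weights are positive. -/
structure Steps.Pos (s : Steps G) : Prop where
  tau : ∀ i, 0 < s.tau i
  sigma : ∀ i, 0 < s.sigma i
  kappa : ∀ e, 0 < s.kappa e

theorem Steps.Pos.normSq_nonneg {s : Steps G} (hs : s.Pos) (U : State q n G) :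
    0 ≤ normSq (opTS q n s) U := by
  rw [normSq_opTS]
  refine add_nonneg (Finset.sum_nonneg fun i _ => ?_) (add_nonneg (Finset.sum_nonneg fun i _ => ?_)
    (Finset.sum_nonneg fun d _ => ?_))
  · have := hs.tau i; positivity
  · have := hs.sigma i; positivity
  · have := hs.kappa (edgeOf d); positivity

theorem Steps.Pos.normSq_pos {s : Steps G} (hs : s.Pos) {U : State q n G} (hU : U ≠ 0) :
    0 < normSq (opTS q n s) U := by
  refine lt_of_le_of_ne (hs.normSq_nonneg U) fun h => hU ?_
  have h1 : 0 ≤ ∑ i, (s.tau i)⁻¹ * ‖State.x U i‖ ^ 2 :=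
    Finset.sum_nonneg fun i _ => by have := hs.tau i; positivity
  have h2 : 0 ≤ ∑ i, (s.sigma i)⁻¹ * ‖State.u U i‖ ^ 2 :=
    Finset.sum_nonneg fun i _ => by have := hs.sigma i; positivity
  have h3 : 0 ≤ ∑ d, (s.kappa (edgeOf d))⁻¹ * ‖State.w U d‖ ^ 2 :=
    Finset.sum_nonneg fun d _ => by have := hs.kappa (edgeOf d); positivity
  rw [normSq_opTS] at h
  have e1 := (Finset.sum_eq_zero_iff_of_nonneg fun i _ => by
    have := hs.tau i; positivity).1 (show ∑ i, (s.tau i)⁻¹ * ‖State.x U i‖ ^ 2 = 0 by linarith)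
  have e2 := (Finset.sum_eq_zero_iff_of_nonneg fun i _ => by
    have := hs.sigma i; positivity).1 (show ∑ i, (s.sigma i)⁻¹ * ‖State.u U i‖ ^ 2 = 0 by linarith)
  have e3 := (Finset.sum_eq_zero_iff_of_nonneg fun d _ => by
    have := hs.kappa (edgeOf d); positivity).1
      (show ∑ d, (s.kappa (edgeOf d))⁻¹ * ‖State.w U d‖ ^ 2 = 0 by linarith)
  refine State.ext (fun i => ?_) (fun i => ?_) fun d => ?_
  · simpa [(hs.tau i).ne'] using e1 i (Finset.mem_univ i)
  · simpa [(hs.sigma i).ne'] using e2 i (Finset.mem_univ i)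
  · simpa [(hs.kappa (edgeOf d)).ne'] using e3 d (Finset.mem_univ d)

theorem Steps.Pos.one_le_condNumber {s : Steps G} (hs : s.Pos) [Nontrivial (State q n G)] :
    1 ≤ condNumber (opTS q n s) :=
  GNE.one_le_condNumber (opTS_isSymmetric s) fun _ => hs.normSq_pos

theorem inner_block (s : Steps G) (i : Fin m) (V Z : State q n G) :
    inner ℝ (State.block i V) (opTS q n s Z) =
      (s.tau i)⁻¹ * inner ℝ (State.x V i) (State.x Z i) +
      ((s.sigma i)⁻¹ * inner ℝ (State.u V i) (State.u Z i) +
      ∑ d : G.Dart with d.fst = i,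
        (s.kappa (edgeOf d))⁻¹ * inner ℝ (State.w V d) (State.w Z d)) := by
  rw [inner_opTS, Finset.sum_filter]
  simp only [State.block, State.x_mk, State.u_mk, State.w_mk]
  congr 1
  · rw [Finset.sum_eq_single i]
    · simp
    · intro j _ hj; simp [hj]
    · simp
  · congr 1
    · rw [Finset.sum_eq_single i]
      · simp
      · intro j _ hj; simp [hj]
      · simp
    · refine Finset.sum_congr rfl fun d _ => ?_
      split_ifs <;> simp

theorem sum_inner_block (s : Steps G) (V Z : State q n G) :
    ∑ i, inner ℝ (State.block i V) (opTS q n s Z) = inner ℝ V (opTS q n s Z) := by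
  rw [inner_opTS]
  simp only [inner_block, Finset.sum_add_distrib, sum_dart_fiberwise]

theorem normSq_block (s : Steps G) (i : Fin m) (V : State q n G) :
    normSq (opTS q n s) (State.block i V) = inner ℝ (State.block i V) (opTS q n s V) := by
  rw [normSq, inner_block, inner_block]
  simp only [State.block, State.x_mk, State.u_mk, State.w_mk, if_true]
  congr 2
  exact Finset.sum_congr rfl fun d hd => by rw [if_pos (Finset.mem_filter.1 hd).2]

theorem sum_normSq_block_div_le {s : Steps G} (hs : s.Pos) {p : Fin m → ℝ} {pmin : ℝ}
    (hpmin : 0 < pmin) (hp : ∀ i, pmin ≤ p i) (V : State q n G) :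
    ∑ i, (p i)⁻¹ * normSq (opTS q n s) (State.block i V) ≤
      pmin⁻¹ * normSq (opTS q n s) V := by
  rw [normSq, ← sum_inner_block, Finset.mul_sum]
  refine Finset.sum_le_sum fun i _ => ?_
  rw [← normSq_block]
  exact mul_le_mul_of_nonneg_right (inv_anti₀ hpmin (hp i)) (hs.normSq_nonneg _)

/-- Different blocks carry different delays, but `T_S` is block diagonal, so the single-delay
estimate applies block by block with the same `γ`. -/
theorem neg_two_inner_delayed_le {Ω : Type*} {s : Steps G} (hs : s.Pos) {γ : ℝ} (hγ : 0 < γ)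
    {ε : ℕ} {U : ℕ → Ω → State q n G} {φ : ℕ → Ω → Fin m → ℕ} {ϕ : ℕ → Ω → G.edgeSet → ℕ}
    (hφ : ∀ k ω i, φ k ω i ≤ ε) (hϕ : ∀ k ω e, ϕ k ω e ≤ ε) (k : ℕ) (ω : Ω) (V : State q n G) :
    -2 * inner ℝ V (opTS q n s (U k ω - delayed U φ ϕ k ω)) ≤
      ε / γ * normSq (opTS q n s) V + γ * ∑ l ∈ Finset.range ε,
        normSq (opTS q n s) (U (k - l) ω - U (k - (l + 1)) ω) := by
  simp only [inner_opTS, normSq_opTS, delayed, State.x_sub, State.u_sub, State.w_sub,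
    PiLp.sub_apply, State.x_mk, State.u_mk, State.w_mk, Finset.sum_add_distrib]
  rw [Finset.sum_comm, Finset.sum_comm (s := Finset.range ε),
    Finset.sum_comm (s := Finset.range ε)]
  simp only [← Finset.mul_sum, mul_add]
  have h1 : -2 * ∑ i, (s.tau i)⁻¹ * inner ℝ (State.x V i)
      (State.x (U k ω) i - State.x (U (k - φ k ω i) ω) i) ≤
      ε / γ * ∑ i, (s.tau i)⁻¹ * ‖State.x V i‖ ^ 2 + γ * ∑ i, (s.tau i)⁻¹ *
        ∑ l ∈ Finset.range ε, ‖State.x (U (k - l) ω) i - State.x (U (k - (l + 1)) ω) i‖ ^ 2 := by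
    simp only [Finset.mul_sum (s := Finset.univ), ← Finset.sum_add_distrib]
    refine Finset.sum_le_sum fun i _ => ?_
    have := mul_le_mul_of_nonneg_left (neg_two_inner_delay_le hγ (hφ k ω i) k (State.x V i)
      fun j => State.x (U j ω) i) (inv_nonneg.2 (hs.tau i).le)
    linarith
  have h2 : -2 * ∑ i, (s.sigma i)⁻¹ * inner ℝ (State.u V i)
      (State.u (U k ω) i - State.u (U (k - φ k ω i) ω) i) ≤
      ε / γ * ∑ i, (s.sigma i)⁻¹ * ‖State.u V i‖ ^ 2 + γ * ∑ i, (s.sigma i)⁻¹ *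
        ∑ l ∈ Finset.range ε, ‖State.u (U (k - l) ω) i - State.u (U (k - (l + 1)) ω) i‖ ^ 2 := by
    simp only [Finset.mul_sum (s := Finset.univ), ← Finset.sum_add_distrib]
    refine Finset.sum_le_sum fun i _ => ?_
    have := mul_le_mul_of_nonneg_left (neg_two_inner_delay_le hγ (hφ k ω i) k (State.u V i)
      fun j => State.u (U j ω) i) (inv_nonneg.2 (hs.sigma i).le)
    linarith
  have h3 : -2 * ∑ d, (s.kappa (edgeOf d))⁻¹ * inner ℝ (State.w V d)
      (State.w (U k ω) d - State.w (U (k - ϕ k ω (edgeOf d)) ω) d) ≤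
      ε / γ * ∑ d, (s.kappa (edgeOf d))⁻¹ * ‖State.w V d‖ ^ 2 +
        γ * ∑ d, (s.kappa (edgeOf d))⁻¹ * ∑ l ∈ Finset.range ε,
          ‖State.w (U (k - l) ω) d - State.w (U (k - (l + 1)) ω) d‖ ^ 2 := by
    simp only [Finset.mul_sum (s := Finset.univ), ← Finset.sum_add_distrib]
    refine Finset.sum_le_sum fun d _ => ?_
    have := mul_le_mul_of_nonneg_left (neg_two_inner_delay_le hγ (hϕ k ω (edgeOf d)) k
      (State.w V d) fun j => State.w (U j ω) d) (inv_nonneg.2 (hs.kappa (edgeOf d)).le)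
    linarith
  linarith

/-- Expand the squares: in the linear term `p_i` cancels and the blocks add up to `V`; in the
quadratic term one factor `1/p_i ≤ 1/pmin` survives, and the blocks are orthogonal for `T_S`. -/
theorem sum_smul_normSq_step_le {s : Steps G} (hs : s.Pos) {p : Fin m → ℝ} {pmin η M C : ℝ}
    (hpmin : 0 < pmin) (hp : ∀ i, pmin ≤ p i) (hsum : ∑ i, p i = 1) (hC : 0 ≤ C)
    (Z V : State q n G) :
    ∑ i, p i * (normSq (opTS q n s) (Z - (η / (M * p i)) • State.block i V) +
        C * normSq (opTS q n s) ((η / (M * p i)) • State.block i V)) ≤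
      normSq (opTS q n s) Z - 2 * (η / M) * inner ℝ V (opTS q n s Z) +
        (η / M) ^ 2 * (1 + C) * (pmin⁻¹ * normSq (opTS q n s) V) := by
  have hterm : ∀ i, p i * (normSq (opTS q n s) (Z - (η / (M * p i)) • State.block i V) +
        C * normSq (opTS q n s) ((η / (M * p i)) • State.block i V)) =
      p i * normSq (opTS q n s) Z -
        2 * (η / M) * inner ℝ (State.block i V) (opTS q n s Z) +
        (η / M) ^ 2 * (1 + C) * ((p i)⁻¹ * normSq (opTS q n s) (State.block i V)) := by
    intro i
    have hpi : p i ≠ 0 := (hpmin.trans_le (hp i)).ne'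
    have h1 : p i * (η / (M * p i)) = η / M := by
      rw [← div_div]; field_simp
    have h2 : p i * (η / (M * p i)) ^ 2 = (η / M) ^ 2 * (p i)⁻¹ := by
      rw [← div_div, div_pow (η / M)]; field_simp
    rw [normSq_sub (opTS_symm s), normSq_smul, real_inner_smul_left]
    linear_combination (-2 * inner ℝ (State.block i V) (opTS q n s Z)) * h1 +
      (1 + C) * normSq (opTS q n s) (State.block i V) * h2
  rw [Finset.sum_congr rfl fun i _ => hterm i, Finset.sum_add_distrib, Finset.sum_sub_distrib,
    ← Finset.sum_mul, ← Finset.mul_sum, ← Finset.mul_sum, hsum, one_mul, sum_inner_block]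
  have := mul_le_mul_of_nonneg_left (sum_normSq_block_div_le hs hpmin hp V)
    (show 0 ≤ (η / M) ^ 2 * (1 + C) by positivity)
  linarith

/-- With `r = √(κ/pmin)` one has `c = 1/r`, and `κ ≥ 1` gives `1/(r pmin) ≤ r`. The delay thus
enters twice with weight `e r`, once from Young's inequality and once from the new increment, whence
the factor `2`. -/
theorem delay_coefficient_le {pmin κ η M e : ℝ} (hpmin : 0 < pmin) (hκ : 1 ≤ κ) (hη : 0 < η)
    (hM : 0 < M) (he : 0 ≤ e) :
    η / M * (e / (M * √(pmin / κ) / η)) - η / M +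
      (η / M) ^ 2 * (1 + √(pmin / κ) * e) * pmin⁻¹ ≤
    -((η⁻¹ - 2 * e * √(κ / pmin) / M - κ / (M * pmin)) / M * η ^ 2) := by
  have hκ0 : 0 < κ := by linarith
  set r := √(κ / pmin) with hr
  have hr0 : 0 < r := Real.sqrt_pos.2 (by positivity)
  have hc : √(pmin / κ) = r⁻¹ := by rw [hr, ← Real.sqrt_inv, inv_div]
  have hr2 : r ^ 2 = κ / pmin := Real.sq_sqrt (by positivity)
  have h1 : r⁻¹ * pmin⁻¹ ≤ r := by
    rw [inv_mul_le_iff₀ hr0, ← pow_two, hr2, inv_eq_one_div]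
    gcongr
  have h2 : pmin⁻¹ ≤ κ / pmin := by rw [inv_eq_one_div]; gcongr
  rw [hc]
  have e1 : η / M * (e / (M * r⁻¹ / η)) - η / M + (η / M) ^ 2 * (1 + r⁻¹ * e) * pmin⁻¹ =
      (η / M) ^ 2 * (e * r + pmin⁻¹ + e * (r⁻¹ * pmin⁻¹)) - η / M := by
    field_simp
    ring
  have e2 : -((η⁻¹ - 2 * e * r / M - κ / (M * pmin)) / M * η ^ 2) =
      (η / M) ^ 2 * (e * r + κ / pmin + e * r) - η / M := by
    field_simp
    ring
  rw [e1, e2]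
  have := mul_le_mul_of_nonneg_left h1 he
  gcongr

/-- The expected one-step decrease of the delay functional, for a fixed past. -/
theorem expected_step_le {Ω : Type*} {s : Steps G} (hs : s.Pos) {p : Fin m → ℝ}
    {pmin κ η c β : ℝ} (hpmin : 0 < pmin) (hp : ∀ i, pmin ≤ p i) (hsum : ∑ i, p i = 1)
    (hm : 0 < m) (hκ : κ = condNumber (opTS q n s)) (hc : c = √(pmin / κ))
    {ε : ℕ} (hβ : β = η⁻¹ - 2 * ε * √(κ / pmin) / m - κ / (m * pmin)) (hβ_pos : 0 < β)
    {U : ℕ → Ω → State q n G} {φ : ℕ → Ω → Fin m → ℕ} {ϕ : ℕ → Ω → G.edgeSet → ℕ}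
    (hφ : ∀ k ω i, φ k ω i ≤ ε) (hϕ : ∀ k ω e, ϕ k ω e ≤ ε) (k : ℕ) (ω : Ω)
    (V Us : State q n G) (hV : 1 / 2 * normSq (opTS q n s) V ≤
      inner ℝ V (opTS q n s (delayed U φ ϕ k ω - Us))) :
    ∑ i, p i * (normSq (opTS q n s) (U k ω - Us - (η / (m * p i)) • State.block i V) +
        c * ε * normSq (opTS q n s) ((η / (m * p i)) • State.block i V)) ≤
      normSq (opTS q n s) (U k ω - Us) + c * ∑ l ∈ Finset.range ε,
        normSq (opTS q n s) (U (k - l) ω - U (k - (l + 1)) ω) -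
        β / m * (η ^ 2 * normSq (opTS q n s) V) := by
  -- The zero space is treated apart because the condition number is at least `1` only in a
  -- nontrivial space.
  rcases subsingleton_or_nontrivial (State q n G) with hsub | hnt
  · have h0 : ∀ W : State q n G, normSq (opTS q n s) W = 0 := fun W => by
      rw [Subsingleton.elim W 0]; simp [normSq]
    simp [h0]
  have hκ1 : 1 ≤ κ := hκ ▸ hs.one_le_condNumber
  have hκ0 : 0 < κ := by linarith
  have hM : (0 : ℝ) < m := by exact_mod_cast hm
  -- Positivity of `η` is forced by that of `β`.
  have hη : 0 < η := by
    rw [← inv_pos]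
    have h1 : 0 ≤ 2 * ε * √(κ / pmin) / m := by positivity
    have h2 : 0 ≤ κ / (m * pmin) := by positivity
    linarith
  have hc0 : 0 < c := hc ▸ Real.sqrt_pos.2 (by positivity)
  refine (sum_smul_normSq_step_le hs (η := η) (M := m) hpmin hp hsum (C := c * ε) (by positivity)
    _ V).trans ?_
  -- This `γ`, after multiplication by `η / m`, gives the past increments weight exactly `c`, the
  -- amount that the delay functional releases.
  have hγ : 0 < m * c / η := by positivity
  have h1 := neg_two_inner_delayed_le (U := U) hs hγ hφ hϕ k ω V
  have h2 : inner ℝ V (opTS q n s (U k ω - Us)) =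
      inner ℝ V (opTS q n s (U k ω - delayed U φ ϕ k ω)) +
        inner ℝ V (opTS q n s (delayed U φ ϕ k ω - Us)) := by
    rw [← inner_add_right, ← map_add, sub_add_sub_cancel]
  set D := ∑ l ∈ Finset.range ε, normSq (opTS q n s) (U (k - l) ω - U (k - (l + 1)) ω)
  have h3 : -2 * inner ℝ V (opTS q n s (U k ω - Us)) ≤
      ε / (m * c / η) * normSq (opTS q n s) V + m * c / η * D - normSq (opTS q n s) V := by
    rw [h2]; linarith
  have h4 := mul_le_mul_of_nonneg_left h3 (show 0 ≤ η / m by positivity)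
  have h5 := mul_le_mul_of_nonneg_right
    (delay_coefficient_le hpmin hκ1 hη hM (Nat.cast_nonneg (α := ℝ) ε)) (hs.normSq_nonneg V)
  rw [← hc, ← hβ] at h5
  have h6 : η / m * (m * c / η * D) = c * D := by field_simp
  linarith

theorem phiNormSq_history {Ω : Type*} (S : State q n G →ₗ[ℝ] State q n G) (c : ℝ) {ε : ℕ}
    (hε : 0 < ε) (U : ℕ → Ω → State q n G) (k : ℕ) (ω : Ω) (Us : State q n G) :
    phiNormSq S c ε (history U ε k ω - fun _ => Us) = normSq S (U k ω - Us) +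
      c * ∑ l ∈ Finset.range ε, ((ε : ℝ) - l) *
        normSq S (U (k - l) ω - U (k - (l + 1)) ω) := by
  have := phiNormSq_eq S c hε fun j => U (k - j) ω - Us
  simp only [sub_sub_sub_cancel_right, Nat.sub_zero] at this
  exact this

theorem phiNormSq_history_succ {Ω : Type*} (S : State q n G →ₗ[ℝ] State q n G) (c : ℝ) {ε : ℕ}
    (hε : 0 < ε) (U : ℕ → Ω → State q n G) (k : ℕ) (ω : Ω) (Us : State q n G) :
    phiNormSq S c ε (history U ε (k + 1) ω - fun _ => Us) = normSq S (U (k + 1) ω - Us) +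
      c * ε * normSq S (U (k + 1) ω - U k ω) +
      c * (∑ l ∈ Finset.range ε, ((ε : ℝ) - l) *
        normSq S (U (k - l) ω - U (k - (l + 1)) ω) -
        ∑ l ∈ Finset.range ε, normSq S (U (k - l) ω - U (k - (l + 1)) ω)) := by
  rw [phiNormSq_history S c hε, sum_delay_succ ε k hε (normSq S) fun j => U j ω]
  ring

theorem Steps.Pos.phiNormSq_history_nonneg {Ω : Type*} {s : Steps G} (hs : s.Pos) {c : ℝ}
    (hc : 0 ≤ c) {ε : ℕ} (hε : 0 < ε) (U : ℕ → Ω → State q n G) (k : ℕ) (ω : Ω)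
    (Us : State q n G) :
    0 ≤ phiNormSq (opTS q n s) c ε (history U ε k ω - fun _ => Us) := by
  rw [phiNormSq_history _ _ hε]
  refine add_nonneg (hs.normSq_nonneg _) (mul_nonneg hc (Finset.sum_nonneg fun l hl => ?_))
  refine mul_nonneg (sub_nonneg.2 ?_) (hs.normSq_nonneg _)
  exact_mod_cast (Finset.mem_range.1 hl).le

end Descent

/-! ### Random variables with finitely many values. -/

section FiniteMeasurable

variable {Ω β γ : Type*}

/-- `f` has finite range and the preimage of every set is measurable. -/
structure FiniteMeasurable (m : MeasurableSpace Ω) (f : Ω → β) : Prop where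
  finite_range : (Set.range f).Finite
  preimage : ∀ s : Set β, MeasurableSet[m] (f ⁻¹' s)

namespace FiniteMeasurable

variable {m m' : MeasurableSpace Ω} {f : Ω → β}

theorem of_singleton (hfin : (Set.range f).Finite) (h : ∀ b, MeasurableSet[m] (f ⁻¹' {b})) :
    FiniteMeasurable m f := by
  refine ⟨hfin, fun s => ?_⟩
  have : f ⁻¹' s = ⋃ b ∈ s ∩ Set.range f, f ⁻¹' {b} := by
    ext ω; simp
  rw [this]
  exact (hfin.subset Set.inter_subset_right).measurableSet_biUnion fun b _ => h b

theorem const (b : β) : FiniteMeasurable m fun _ : Ω => b :=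
  of_singleton ((Set.finite_singleton b).subset (by rintro _ ⟨_, rfl⟩; rfl)) fun _ =>
    MeasurableSet.const _

theorem mono (hf : FiniteMeasurable m f) (h : m ≤ m') : FiniteMeasurable m' f :=
  ⟨hf.1, fun s => h _ (hf.2 s)⟩

theorem comp (hf : FiniteMeasurable m f) (g : β → γ) : FiniteMeasurable m fun ω => g (f ω) :=
  ⟨(hf.1.image g).subset (by rintro _ ⟨ω, rfl⟩; exact ⟨f ω, ⟨ω, rfl⟩, rfl⟩),
    fun s => hf.2 (g ⁻¹' s)⟩

theorem prod (hf : FiniteMeasurable m f) {g : Ω → γ} (hg : FiniteMeasurable m g) :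
    FiniteMeasurable m fun ω => (f ω, g ω) := by
  refine of_singleton ((hf.1.prod hg.1).subset ?_) ?_
  · rintro _ ⟨ω, rfl⟩; exact ⟨⟨ω, rfl⟩, ⟨ω, rfl⟩⟩
  · rintro ⟨b, c⟩
    convert (hf.2 {b}).inter (hg.2 {c}) using 1
    ext ω; simp

theorem pi {ι : Type*} [Finite ι] {f : ι → Ω → β} (hf : ∀ i, FiniteMeasurable m (f i)) :
    FiniteMeasurable m fun ω i => f i ω := by
  refine of_singleton ((Set.Finite.pi' fun i => (hf i).1).subset ?_) fun b => ?_
  · rintro _ ⟨ω, rfl⟩ i; exact ⟨ω, rfl⟩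
  · have : (fun ω i => f i ω) ⁻¹' {b} = ⋂ i, f i ⁻¹' {b i} := by
      ext ω; simp [funext_iff]
    rw [this]
    exact MeasurableSet.iInter fun i => (hf i).2 _

theorem measurable (hf : FiniteMeasurable m f) (mβ : MeasurableSpace β) : Measurable[m, mβ] f :=
  fun s _ => hf.2 s

theorem comap_le (hf : FiniteMeasurable m f) (mβ : MeasurableSpace β) :
    MeasurableSpace.comap f mβ ≤ m :=
  (hf.measurable mβ).comap_le

theorem of_comap_le [TopologicalSpace β] [T1Space β] (hfin : (Set.range f).Finite)
    (h : MeasurableSpace.comap f (borel β) ≤ m) : FiniteMeasurable m f := by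
  borelize β
  exact of_singleton hfin fun b => h _ ⟨{b}, (measurableSet_singleton b), rfl⟩

theorem stronglyMeasurable {f : Ω → ℝ} (hf : FiniteMeasurable m f) : StronglyMeasurable[m] f :=
  (hf.measurable inferInstance).stronglyMeasurable

theorem integrable {f : Ω → ℝ} (hf : FiniteMeasurable m f) (P : Measure[m] Ω)
    [IsFiniteMeasure P] : Integrable f P := by
  obtain ⟨C, hC⟩ := (hf.1.image norm).bddAbove
  exact Integrable.of_bound hf.stronglyMeasurable.aestronglyMeasurable C
    (ae_of_all _ fun ω => hC ⟨f ω, ⟨ω, rfl⟩, rfl⟩)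

end FiniteMeasurable

end FiniteMeasurable

/-! ### Conditional expectation over an independent index; supermartingale convergence. -/

section Conditional

variable {Ω : Type*} {ι : Type*} [Fintype ι] [MeasurableSpace ι] [MeasurableSingletonClass ι]

/-- Conditional expectation of a past-dependent quantity that is selected by an independent
index. -/
theorem condExp_select {Z mΩ : MeasurableSpace Ω} (P : Measure Ω) [IsProbabilityMeasure P]
    (hZ : Z ≤ mΩ) {a : Ω → ι} (ha : Measurable a)
    (hind : Indep (MeasurableSpace.comap a inferInstance) Z P) {F : ι → Ω → ℝ}
    (hF : ∀ i, FiniteMeasurable Z (F i)) :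
    P[fun ω => F (a ω) ω | Z] =ᵐ[P] fun ω => ∑ i, P.real {ω | a ω = i} * F i ω := by
  classical
  have hmeas : ∀ i, MeasurableSet[MeasurableSpace.comap a inferInstance] {ω | a ω = i} :=
    fun i => ⟨{i}, measurableSet_singleton i, rfl⟩
  have hmeas' : ∀ i, MeasurableSet {ω | a ω = i} := fun i => ha.comap_le _ (hmeas i)
  have hInt : ∀ i, Integrable (({ω | a ω = i}.indicator (1 : Ω → ℝ)) * F i) P := fun i => by
    have : ({ω | a ω = i}.indicator (1 : Ω → ℝ)) * F i = {ω | a ω = i}.indicator (F i) := by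
      ext ω; by_cases h : a ω = i <;> simp [h]
    rw [this]
    exact (((hF i).mono hZ).integrable P).indicator (hmeas' i)
  -- Split according to the value of the index: each `F i` is known given `Z`, and each indicator is
  -- independent of `Z`.
  have hsum : (fun ω => F (a ω) ω) = ∑ i, ({ω | a ω = i}.indicator (1 : Ω → ℝ)) * F i := by
    ext ω
    rw [Finset.sum_apply, Finset.sum_eq_single (a ω)]
    · simp
    · intro i _ hi; simp [hi.symm]
    · simp
  rw [hsum]
  refine (condExp_finsetSum (fun i _ => hInt i) Z).trans ?_
  have key : ∀ i, P[({ω | a ω = i}.indicator (1 : Ω → ℝ)) * F i | Z] =ᵐ[P]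
      fun ω => P.real {ω | a ω = i} * F i ω := fun i => by
    refine (condExp_mul_of_stronglyMeasurable_right (hF i).stronglyMeasurable (hInt i)
      ((integrable_const (1 : ℝ)).indicator (hmeas' i))).trans ?_
    have h1 := condExp_indep_eq (μ := P) (f := {ω | a ω = i}.indicator (1 : Ω → ℝ)) ha.comap_le hZ
      (stronglyMeasurable_one.indicator (hmeas i)) hind
    filter_upwards [h1] with ω hω
    rw [Pi.mul_apply, hω, integral_indicator_one (hmeas' i)]
  filter_upwards [ae_all_iff.2 key] with ω hω
  rw [Finset.sum_apply]
  exact Finset.sum_congr rfl fun i _ => hω i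

/-- A nonnegative supermartingale with deterministic initial value converges almost surely. -/
theorem ae_tendsto_of_nonneg_supermartingale {mΩ : MeasurableSpace Ω} {P : Measure Ω}
    [IsProbabilityMeasure P] {ℱ : Filtration ℕ mΩ} {f : ℕ → Ω → ℝ} (hf : Supermartingale f ℱ P)
    (hnonneg : ∀ k ω, 0 ≤ f k ω) :
    ∀ᵐ ω ∂P, ∃ l, Tendsto (fun k => f k ω) atTop (𝓝 l) := by
  have hb : ∀ k, eLpNorm ((-f) k) 1 P ≤ ((∫ ω, f 0 ω ∂P).toNNReal : ENNReal) := fun k => by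
    rw [Pi.neg_apply, eLpNorm_neg, eLpNorm_one_eq_lintegral_enorm]
    have : ∫⁻ ω, ‖f k ω‖ₑ ∂P = ENNReal.ofReal (∫ ω, f k ω ∂P) := by
      rw [ofReal_integral_eq_lintegral_ofReal (hf.integrable k) (ae_of_all _ (hnonneg k))]
      exact lintegral_congr fun ω => Real.enorm_of_nonneg (hnonneg k ω)
    rw [this]
    refine ENNReal.ofReal_le_ofReal ?_
    have := hf.setIntegral_le (Nat.zero_le k) MeasurableSet.univ
    simpa using this
  filter_upwards [hf.neg.exists_ae_tendsto_of_bdd hb] with ω ⟨l, hl⟩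
  refine ⟨-l, ?_⟩
  simpa using hl.neg

end Conditional

/-! ### Measurability of the iterates with respect to the past. -/

section Trajectory

variable {m q : ℕ} {n : Fin m → ℕ} {G : SimpleGraph (Fin m)} {Ω : Type*}

theorem pastInfo_mono (act : ℕ → Ω → Fin m) (φ : ℕ → Ω → Fin m → ℕ)
    (ϕ : ℕ → Ω → G.edgeSet → ℕ) : Monotone (pastInfo act φ ϕ) := fun _ _ h =>
  sup_le_sup (biSup_mono fun _ hi => Finset.range_mono h hi)
    (biSup_mono fun _ hi => Finset.range_mono (Nat.succ_le_succ h) hi)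

theorem sigmaZ_mono {E : Type*} [TopologicalSpace E] (U V : ℕ → Ω → E) :
    Monotone (sigmaZ U V) := fun _ _ h =>
  sup_le_sup le_rfl (biSup_mono fun _ hi => Finset.Icc_subset_Icc_right h hi)

theorem comap_le_sigmaZ {E : Type*} [TopologicalSpace E] (U V : ℕ → Ω → E) {j k : ℕ}
    (h : j ≤ k) : MeasurableSpace.comap (U j) (borel E) ≤ sigmaZ U V k := by
  rcases Nat.eq_zero_or_pos j with rfl | hj
  · exact le_sup_left
  · exact le_sup_of_le_right (le_sup_left.trans (le_iSup₂_of_le j (Finset.mem_Icc.2 ⟨hj, h⟩) le_rfl))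

theorem comap_le_sigmaZ' {E : Type*} [TopologicalSpace E] (U V : ℕ → Ω → E) {k : ℕ}
    (h : 0 < k) : MeasurableSpace.comap (V k) (borel E) ≤ sigmaZ U V k :=
  le_sup_of_le_right (le_sup_right.trans (le_iSup₂_of_le k (Finset.mem_Icc.2 ⟨h, le_rfl⟩) le_rfl))

theorem sigmaZ_le {E : Type*} [TopologicalSpace E] {U V : ℕ → Ω → E} {M : MeasurableSpace Ω}
    {k : ℕ} (hU : ∀ j ≤ k, FiniteMeasurable M (U j)) (hV : ∀ j ≤ k, FiniteMeasurable M (V j)) :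
    sigmaZ U V k ≤ M :=
  sup_le ((hU 0 (Nat.zero_le k)).comap_le _) (iSup₂_le fun j hj =>
    sup_le ((hU j (Finset.mem_Icc.1 hj).2).comap_le _) ((hV j (Finset.mem_Icc.1 hj).2).comap_le _))

theorem pastInfo_le {mΩ : MeasurableSpace Ω} {act : ℕ → Ω → Fin m} (hact : ∀ k, Measurable (act k))
    {φ : ℕ → Ω → Fin m → ℕ} (hφ : ∀ k, Measurable (φ k)) {ϕ : ℕ → Ω → G.edgeSet → ℕ}
    (hϕ : ∀ k, Measurable (ϕ k)) (k : ℕ) : pastInfo act φ ϕ k ≤ mΩ :=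
  sup_le (iSup₂_le fun j _ => (hact j).comap_le)
    (iSup₂_le fun j _ => sup_le (hφ j).comap_le (hϕ j).comap_le)

theorem finiteMeasurable_bounded {ι : Type*} [Finite ι] {M : MeasurableSpace Ω} {f : Ω → ι → ℕ}
    {ε : ℕ} (hf : ∀ ω i, f ω i ≤ ε) (h : MeasurableSpace.comap f inferInstance ≤ M) :
    FiniteMeasurable M f := by
  refine .of_singleton ((Set.Finite.pi' fun _ => Set.finite_Iic ε).subset ?_) fun b =>
    h _ ⟨{b}, measurableSet_singleton b, rfl⟩
  rintro _ ⟨ω, rfl⟩ i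
  exact hf ω i

theorem finiteMeasurable_delayed {M : MeasurableSpace Ω} {U : ℕ → Ω → State q n G}
    {φ : ℕ → Ω → Fin m → ℕ} {ϕ : ℕ → Ω → G.edgeSet → ℕ} {k : ℕ}
    (hφ : FiniteMeasurable M (φ k)) (hϕ : FiniteMeasurable M (ϕ k))
    (hU : ∀ j ≤ k, FiniteMeasurable M (U j)) : FiniteMeasurable M (delayed U φ ϕ k) :=
  ((hφ.prod hϕ).prod (FiniteMeasurable.pi fun j : Fin (k + 1) =>
    hU j (Nat.lt_succ_iff.1 j.2))).comp fun T => State.mk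
      (fun i => State.x (T.2 ⟨k - T.1.1 i, Nat.lt_succ_of_le (Nat.sub_le _ _)⟩) i)
      (fun i => State.u (T.2 ⟨k - T.1.1 i, Nat.lt_succ_of_le (Nat.sub_le _ _)⟩) i)
      fun d => State.w (T.2 ⟨k - T.1.2 (edgeOf d), Nat.lt_succ_of_le (Nat.sub_le _ _)⟩) d

/-- The iterates and their delayed versions take finitely many values and are determined by the
past activations and delays. -/
theorem finiteMeasurable_trajectory {act : ℕ → Ω → Fin m} {φ : ℕ → Ω → Fin m → ℕ}
    {ϕ : ℕ → Ω → G.edgeSet → ℕ} {ε : ℕ} (hφ : ∀ k ω i, φ k ω i ≤ ε) (hϕ : ∀ k ω e, ϕ k ω e ≤ ε)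
    {U : ℕ → Ω → State q n G} {U₀ : State q n G} (hU0 : ∀ ω, U 0 ω = U₀)
    (step : Fin m → State q n G → State q n G → State q n G)
    (hU : ∀ k ω, U (k + 1) ω = step (act k ω) (U k ω) (delayed U φ ϕ k ω)) (k : ℕ) :
    FiniteMeasurable (pastInfo act φ ϕ k) (U k) ∧
      FiniteMeasurable (pastInfo act φ ϕ k) (delayed U φ ϕ k) := by
  have hφ' : ∀ k, FiniteMeasurable (pastInfo act φ ϕ k) (φ k) := fun k =>
    finiteMeasurable_bounded (hφ k) (le_sup_of_le_right (le_iSup₂_of_le k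
      (Finset.self_mem_range_succ k) le_sup_left))
  have hϕ' : ∀ k, FiniteMeasurable (pastInfo act φ ϕ k) (ϕ k) := fun k =>
    finiteMeasurable_bounded (hϕ k) (le_sup_of_le_right (le_iSup₂_of_le k
      (Finset.self_mem_range_succ k) le_sup_right))
  -- The activation at time `k` is known only at time `k + 1`, whereas the delays of iteration `k`
  -- are already known at time `k`.
  have hact : ∀ k, FiniteMeasurable (pastInfo act φ ϕ (k + 1)) (act k) := fun k =>
    .of_singleton (Set.toFinite _) fun b =>
      (le_sup_of_le_left (le_iSup₂_of_le k (Finset.self_mem_range_succ k) le_rfl) :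
        MeasurableSpace.comap (act k) inferInstance ≤ pastInfo act φ ϕ (k + 1)) _
        ⟨{b}, measurableSet_singleton b, rfl⟩
  induction k using Nat.strong_induction_on with
  | _ k ih =>
    have hUk : FiniteMeasurable (pastInfo act φ ϕ k) (U k) := by
      cases k with
      | zero => rw [funext hU0]; exact .const U₀
      | succ k =>
        obtain ⟨h1, h2⟩ := ih k (Nat.lt_succ_self k)
        have hmono := pastInfo_mono act φ ϕ (Nat.le_succ k)
        rw [funext (hU k)]
        exact (((hact k).prod (h1.mono hmono)).prod (h2.mono hmono)).comp
          fun T => step T.1.1 T.1.2 T.2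
    refine ⟨hUk, finiteMeasurable_delayed (hφ' k) (hϕ' k) fun j hj => ?_⟩
    rcases hj.lt_or_eq with hlt | rfl
    · exact (ih j hlt).1.mono (pastInfo_mono act φ ϕ hj)
    · exact hUk

end Trajectory

/-! ### The functional one step ahead, and the main theorem. -/

section Final

variable {m q : ℕ} {n : Fin m → ℕ} {G : SimpleGraph (Fin m)} [DecidableRel G.Adj]

theorem Steps.Admissible.pos {s : Steps G} {g : Game m q n} {L μ : ℝ} {α : Fin m → ℝ}
    (hs : s.Admissible g L μ α) : s.Pos :=
  ⟨hs.tau_pos, hs.sigma_pos, hs.kappa_pos⟩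

/-- The value of the delay functional at time `k + 1` if the increment at time `k` is `-D`. -/
noncomputable def phiNext {Ω : Type*} (S : State q n G →ₗ[ℝ] State q n G) (c : ℝ) (ε : ℕ)
    (U : ℕ → Ω → State q n G) (Us : State q n G) (k : ℕ) (ω : Ω) (D : State q n G) : ℝ :=
  normSq S (U k ω - Us - D) + c * ε * normSq S D +
    c * (∑ l ∈ Finset.range ε, ((ε : ℝ) - l) * normSq S (U (k - l) ω - U (k - (l + 1)) ω) -
      ∑ l ∈ Finset.range ε, normSq S (U (k - l) ω - U (k - (l + 1)) ω))

theorem phiNormSq_history_succ_eq_phiNext {Ω : Type*} (S : State q n G →ₗ[ℝ] State q n G) (c : ℝ)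
    {ε : ℕ} (hε : 0 < ε) (U : ℕ → Ω → State q n G) (Us : State q n G) (k : ℕ) (ω : Ω)
    {D : State q n G} (hD : U (k + 1) ω = U k ω - D) :
    phiNormSq S c ε (history U ε (k + 1) ω - fun _ => Us) = phiNext S c ε U Us k ω D := by
  rw [phiNormSq_history_succ S c hε, phiNext, hD, sub_sub_cancel_left, normSq_neg, sub_right_comm]

theorem finiteMeasurable_phiNext {Ω : Type*} {M : MeasurableSpace Ω}
    (S : State q n G →ₗ[ℝ] State q n G) (c : ℝ) (ε : ℕ) {U : ℕ → Ω → State q n G}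
    (Us : State q n G) {k : ℕ} (hU : ∀ j ≤ k, FiniteMeasurable M (U j)) {D : Ω → State q n G}
    (hD : FiniteMeasurable M D) :
    FiniteMeasurable M fun ω => phiNext S c ε U Us k ω (D ω) := by
  -- Only times up to `k` occur, so truncating indices by `min j k` shows the value to be a function
  -- of finitely many iterates.
  have h := ((FiniteMeasurable.pi fun j : Fin (k + 1) => hU j (Nat.lt_succ_iff.1 j.2)).prod hD).comp
    fun T => phiNext S c ε (fun j H => H ⟨min j k, Nat.lt_succ_of_le (min_le_right j k)⟩) Us k
      T.1 T.2
  simpa only [phiNext, min_self, min_eq_left (Nat.sub_le _ _)] using h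

theorem finiteMeasurable_phiNormSq_history {Ω : Type*} {M : MeasurableSpace Ω}
    (S : State q n G →ₗ[ℝ] State q n G) (c : ℝ) (ε : ℕ) {U : ℕ → Ω → State q n G}
    (Us : State q n G) {k : ℕ} (hU : ∀ j ≤ k, FiniteMeasurable M (U j)) :
    FiniteMeasurable M fun ω => phiNormSq S c ε (history U ε k ω - fun _ => Us) :=
  (FiniteMeasurable.pi fun j : Fin (ε + 1) => hU (k - j) (Nat.sub_le _ _)).comp
    fun H => phiNormSq S c ε (H - fun _ => Us)

end Final

end GNE

theorem theorem2 {m q : ℕ} {n : Fin m → ℕ}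
    -- the communication graph is undirected and connected
    (G : SimpleGraph (Fin m)) [DecidableRel G.Adj] (hG : G.Connected)
    -- the game and the step-sizes
    (g : GNE.Game m q n) (hg : g.Regular)
    (L μ : ℝ) (hF : g.PseudoGradRegular L μ)
    (s : GNE.Steps G) (α : Fin m → ℝ) (hs : s.Admissible g L μ α)
    -- random activations with probabilities `p i`, and delays bounded by `ε`
    {Ω : Type*} [mΩ : MeasurableSpace Ω] (P : Measure Ω) [IsProbabilityMeasure P]
    (p : Fin m → ℝ) (hp : ∀ i, 0 < p i)
    (act : ℕ → Ω → Fin m) (hact : ∀ k, Measurable (act k))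
    (hlaw : ∀ k i, P {ω | act k ω = i} = ENNReal.ofReal (p i))
    (ε : ℕ) (hε : 0 < ε)
    (φ : ℕ → Ω → Fin m → ℕ) (hφ : ∀ k, Measurable (φ k)) (hφε : ∀ k ω i, φ k ω i ≤ ε)
    (ϕ : ℕ → Ω → G.edgeSet → ℕ) (hϕ : ∀ k, Measurable (ϕ k)) (hϕε : ∀ k ω e, ϕ k ω e ≤ ε)
    (hindep : ∀ k, Indep (MeasurableSpace.comap (act k) inferInstance)
      (GNE.pastInfo act φ ϕ k) P)
    -- the sequence of the asynchronous algorithm, with relaxation factors `η / (m * p i)`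
    (η : ℝ) (U₀ : GNE.State q n G) (U : ℕ → Ω → GNE.State q n G)
    (hU0 : ∀ ω, U 0 ω = U₀)
    (hU : ∀ k ω, U (k + 1) ω = U k ω -
      (η / (m * p (act k ω))) • GNE.opRi g s (act k ω) (GNE.delayed U φ ϕ k ω))
    -- the constants
    (pmin κS c β : ℝ) (hpmin : pmin = ⨅ i, p i)
    (hκS : κS = GNE.condNumber (GNE.opTS q n s))
    (hc : c = √(pmin / κS))
    (hβ : β = η⁻¹ - 2 * ε * √(κS / pmin) / m - κS / (m * pmin)) (hβ_pos : 0 < β)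
    -- the reference point
    (Ustar : GNE.State q n G) (hUstar : Ustar ∈ GNE.zeros g G) :
    (∀ k,
      GNE.sigmaZ U (GNE.delayed U φ ϕ) k ≤ mΩ ∧
      Integrable (fun ω => GNE.phiNormSq (GNE.opTS q n s) c ε
        (GNE.history U ε k ω - fun _ => Ustar)) P ∧
      P[fun ω => GNE.phiNormSq (GNE.opTS q n s) c ε (GNE.history U ε (k + 1) ω - fun _ => Ustar) |
          GNE.sigmaZ U (GNE.delayed U φ ϕ) k] ≤ᵐ[P]
        fun ω => GNE.phiNormSq (GNE.opTS q n s) c ε (GNE.history U ε k ω - fun _ => Ustar) -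
          β / m * GNE.normSq (GNE.opTS q n s)
            ((U k ω - η • GNE.opR g s (GNE.delayed U φ ϕ k ω)) - U k ω)) ∧
    ∃ Ω' : Set Ω, MeasurableSet Ω' ∧ P Ω' = 1 ∧ ∀ ω ∈ Ω', ∃ l : ℝ,
      Tendsto (fun k => GNE.phiNormSq (GNE.opTS q n s) c ε
        (GNE.history U ε k ω - fun _ => Ustar)) atTop (𝓝 l) := by
  classical
  have hpos := hs.pos
  have hm : 0 < m := by
    obtain ⟨i⟩ := hG.nonempty
    exact i.pos
  have hne : Nonempty (Fin m) := hG.nonempty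
  have hpmin_le : ∀ i, pmin ≤ p i := fun i => hpmin ▸ ciInf_le (Set.finite_range p).bddBelow i
  have hpmin_pos : 0 < pmin := by
    obtain ⟨i, hi⟩ := exists_eq_ciInf_of_finite (f := p)
    rw [hpmin, ← hi]; exact hp i
  have hreal : ∀ k i, P.real {ω | act k ω = i} = p i := fun k i => by
    rw [measureReal_def, hlaw, ENNReal.toReal_ofReal (hp i).le]
  have hsum : ∑ i, p i = 1 := by
    have h := measureReal_biUnion_finset (μ := P) (s := Finset.univ)
      (f := fun i => {ω | act 0 ω = i})
      (fun i _ j _ hij => Set.disjoint_left.2 fun ω hi hj => hij (hi.symm.trans hj))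
      fun i _ => hact 0 (measurableSet_singleton i)
    simp only [hreal] at h
    rw [← h, show (⋃ i ∈ (Finset.univ : Finset (Fin m)), {ω | act 0 ω = i}) = Set.univ by
      ext ω; simp, probReal_univ]
  have htraj := GNE.finiteMeasurable_trajectory hφε hϕε hU0
    (fun i u v => u - (η / (m * p i)) • GNE.opRi g s i v) hU
  have hpast : ∀ k, GNE.pastInfo act φ ϕ k ≤ mΩ := GNE.pastInfo_le hact hφ hϕ
  have hmono := GNE.pastInfo_mono act φ ϕ
  have hZpast : ∀ k, GNE.sigmaZ U (GNE.delayed U φ ϕ) k ≤ GNE.pastInfo act φ ϕ k := fun k =>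
    GNE.sigmaZ_le (fun j hj => (htraj j).1.mono (hmono hj)) fun j hj => (htraj j).2.mono (hmono hj)
  have hZ : ∀ k, GNE.sigmaZ U (GNE.delayed U φ ϕ) k ≤ mΩ := fun k => (hZpast k).trans (hpast k)
  have hUZ : ∀ k, ∀ j ≤ k, GNE.FiniteMeasurable (GNE.sigmaZ U (GNE.delayed U φ ϕ) k) (U j) :=
    fun k j hj => .of_comap_le (htraj j).1.finite_range (GNE.comap_le_sigmaZ _ _ hj)
  have hVZ : ∀ k, GNE.FiniteMeasurable (GNE.sigmaZ U (GNE.delayed U φ ϕ) k)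
      (GNE.delayed U φ ϕ k) := fun k => by
    -- The σ-algebra at time `0` does not contain the delayed iterate; there it is the constant
    -- `U₀`, since truncated subtraction returns time `0` for every delay.
    rcases Nat.eq_zero_or_pos k with rfl | hk
    · have : GNE.delayed U φ ϕ 0 = fun _ => U₀ := by
        funext ω
        refine GNE.State.ext (fun i => ?_) (fun i => ?_) fun d => ?_ <;>
          simp [GNE.delayed, hU0]
      rw [this]; exact .const U₀
    · exact .of_comap_le (htraj k).2.finite_range (GNE.comap_le_sigmaZ' _ _ hk)
  have hint : ∀ k, Integrable (fun ω => GNE.phiNormSq (GNE.opTS q n s) c ε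
      (GNE.history U ε k ω - fun _ => Ustar)) P := fun k =>
    (GNE.finiteMeasurable_phiNormSq_history _ c ε Ustar fun j hj =>
      (hUZ k j hj).mono (hZ k)).integrable P
  have hstep : ∀ k, P[fun ω => GNE.phiNormSq (GNE.opTS q n s) c ε
        (GNE.history U ε (k + 1) ω - fun _ => Ustar) | GNE.sigmaZ U (GNE.delayed U φ ϕ) k] ≤ᵐ[P]
      fun ω => GNE.phiNormSq (GNE.opTS q n s) c ε (GNE.history U ε k ω - fun _ => Ustar) -
        β / m * GNE.normSq (GNE.opTS q n s)
          ((U k ω - η • GNE.opR g s (GNE.delayed U φ ϕ k ω)) - U k ω) := fun k => by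
    -- Independence is assumed from activations and delays; it passes to the σ-algebra of the
    -- iterates, which is contained in theirs.
    have hsel := GNE.condExp_select P (hZ k) (hact k)
      (indep_of_indep_of_le_right (hindep k) (hZpast k))
      (F := fun i ω => GNE.phiNext (GNE.opTS q n s) c ε U Ustar k ω
        ((η / (m * p i)) • GNE.opRi g s i (GNE.delayed U φ ϕ k ω)))
      fun i => GNE.finiteMeasurable_phiNext _ c ε Ustar (hUZ k)
        ((hVZ k).comp fun v => (η / (m * p i)) • GNE.opRi g s i v)
    have hfun : (fun ω => GNE.phiNormSq (GNE.opTS q n s) c ε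
        (GNE.history U ε (k + 1) ω - fun _ => Ustar)) = fun ω =>
        GNE.phiNext (GNE.opTS q n s) c ε U Ustar k ω
          ((η / (m * p (act k ω))) • GNE.opRi g s (act k ω) (GNE.delayed U φ ϕ k ω)) :=
      funext fun ω => GNE.phiNormSq_history_succ_eq_phiNext _ c hε U Ustar k ω (hU k ω)
    rw [hfun]
    filter_upwards [hsel] with ω hω
    rw [hω]
    have hdet := GNE.expected_step_le hpos hpmin_pos hpmin_le hsum hm hκS hc hβ hβ_pos
      (U := U) hφε hϕε k ω (GNE.opR g s (GNE.delayed U φ ϕ k ω)) Ustar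
      (GNE.half_normSq_opR_le hg hF hs hUstar _)
    simp only [hreal, GNE.phiNext, mul_add _ (_ + _), Finset.sum_add_distrib, ← Finset.sum_mul,
      hsum, one_mul]
    rw [GNE.phiNormSq_history _ c hε, sub_sub_cancel_left, GNE.normSq_neg, GNE.normSq_smul]
    simp only [GNE.opRi, mul_add, Finset.sum_add_distrib] at hdet ⊢
    linarith
  refine ⟨fun k => ⟨hZ k, hint k, hstep k⟩, ?_⟩
  let ℱ : Filtration ℕ mΩ := ⟨GNE.sigmaZ U (GNE.delayed U φ ϕ), GNE.sigmaZ_mono _ _, hZ⟩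
  have hsuper : Supermartingale (fun k ω => GNE.phiNormSq (GNE.opTS q n s) c ε
      (GNE.history U ε k ω - fun _ => Ustar)) ℱ P := by
    refine supermartingale_nat (fun k => (GNE.finiteMeasurable_phiNormSq_history _ c ε Ustar
      (hUZ k)).stronglyMeasurable) hint fun k => ?_
    filter_upwards [hstep k] with ω hω
    refine hω.trans (sub_le_self _ (mul_nonneg ?_ (hpos.normSq_nonneg _)))
    positivity
  have hae := GNE.ae_tendsto_of_nonneg_supermartingale hsuper fun k ω =>
    hpos.phiNormSq_history_nonneg (hc ▸ Real.sqrt_nonneg _) hε U k ω Ustar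
  -- Shrink the almost-sure set to a measurable one, as the complement of a measurable null superset
  -- of its complement.
  obtain ⟨t, ht, htm, ht1⟩ := eventually_iff_exists_mem.1 hae |>.elim fun v hv =>
    (show ∃ t, t ⊆ v ∧ MeasurableSet t ∧ P tᶜ = 0 from by
      obtain ⟨t, h1, h2, h3⟩ := exists_measurable_superset_of_null (mem_ae_iff.1 hv.1)
      exact ⟨tᶜ, Set.compl_subset_comm.1 h1, h2.compl, by rwa [compl_compl]⟩).imp
      fun t h => And.intro (fun ω hω => hv.2 ω (h.1 hω)) h.2
  exact ⟨t, htm, (prob_compl_eq_zero_iff htm).1 ht1, ht⟩
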